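/- **Setting.** For a countable index set $I$, a multi-index on $I$ is a finitely supported $\alpha:I\to\mathbb N_0$, and $h^\alpha=\prod_i h_i^{\alpha_i}$ for $h\in\mathbb R^I$. A function $g:D\to\mathbb R$, $D\subset\mathbb R^I$, is *analytic at* $x_0$ with monomial expansion $\sum_\alpha c_\alpha (x-x_0)^\alpha$ if there is $v\in\mathbb R^I$ with all $v_i\neq0$ such that $\sum_\alpha|c_\alpha v^\alpha|<\infty$ and, for every $h\in\mathbb R^I$ with $|h_i|\le|v_i|$ for all $i$, $x_0+h\in D$ and $g(x_0+h)=\sum_\alpha c_\alpha h^\alpha$. If $v$ can be chosen with moreover $\sum_i|v_i|^{-p}<\infty$, the expansion is said to be *absolutely convergent at a point near $\infty$ in the topology $\mathcal T^p$*. (As convergence is absolute, convergence at $v$ is the same for $\sum c_\alpha h^\alpha$ and for its majorant $\sum|c_\alpha|h^\alpha$.) Let $m\ge1$, $1\le p<\infty$, and let $p'\in(1,\infty]$ be the Hölder conjugate of $p$. Let $\mathbb I_m=\{(\beta,j):\beta \text{ a multi-index on }\mathbb N,\ 0\le j<m,\ 1\le|\beta|+j\le m\}$. Consider, for $t\in\mathbb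 R$ and $x=(x_i)_{i\in\mathbb N}\in\mathbb R^{\mathbb N}$, the Cauchy problem $$\partial_t^m u(t,x)=f\big(t,x,u,(\partial_x^\beta\partial_t^j u)_{(\beta,j)\in\mathbb I_m}\big),\qquad \partial_t^k u(t,x)|_{t=0}=\phi_k(x),\quad 0\le k\le m-1,\tag{1}$$ where $f$ is a real function on a subset of $\mathbb R\times\mathbb R^{\mathbb N}\times\mathbb R\times\mathbb R^{\mathbb I_m}$ and the $\phi_k$ are real functions on subsets of $\mathbb R^{\mathbb N}$. Assume that each $\phi_k$ is analytic at $0$, and that $f$ is analytic at the point $\big(0,0,\phi_0(0),(\partial_x^\beta\phi_j(0))_{(\beta,j)\in\mathbb I_m}\big)$, with monomial expansions absolutely convergent at a point near $\infty$ in the topology $\mathcal T^p$ (equivalently, so are the expansions at $0$ of the majorants $\Phi_k$ and $F$ obtained by replacing the coefficients by their absolute values). Write $\mathbb N_0=\{0\}\cup\mathbb N$, identify $(t,x)$ with an element of $\mathbb R^{\mathbb N_0}$, and let $B_r=\{z\in\ell^{p'}(\mathbb N_0):\|z\|_{\ell^{p'}}<r\}$. For $r>0$, a *local analytic solution on $B_r$*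 is a real function $u$ on $B_r$ that is analytic at $0$, equals its absolutely convergent monomial expansion at $0$ on all of $B_r$, has all partial derivatives of order $\le m$ on $B_r$, and satisfies (1) on $B_r$ (in particular the arguments of $f$ and of the $\phi_k$ in (1) lie in their domains). **Theorem.** Under these assumptions: 1. (Existence) For some $r>0$ there is a local analytic solution of (1) on $B_r$. 2. (Uniqueness) If $u_1,u_2$ are local analytic solutions on $B_{r_1}$ and $B_{r_2}$, then $u_1=u_2$ on $B_{r_1}\cap B_{r_2}$. 3. (Regularity) If $u$ is a local analytic solution on $B_r$, there is $0<s\le r$ such that $u$ is Fréchet differentiable on $B_s$ with respect to $\ell^{p'}(\mathbb N_0)$, and its Fréchet derivative $Du:B_s\to(\ell^{p'}(\mathbb N_0))^*$ is continuous. -/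

import Mathlib

open scoped ENNReal

noncomputable section

namespace InfCK

/-- The monomial `h ^ α`, the finite product of the `h i ^ α i`. -/
def monomial {ι : Type*} (h : ι → ℝ) (α : ι →₀ ℕ) : ℝ :=
  α.prod fun i k => h i ^ k

/-- The real function `f` with domain `D` has at `x₀` the monomial expansion
`∑ c α (x - x₀) ^ α`, absolutely convergent at the point `v` (all of whose coordinates are
nonzero), and equals it on the whole box `|h i| ≤ |v i|`, which is contained in the domain. -/
def HasMonomialExpansion {ι : Type*} (D : Set (ι → ℝ)) (f : (ι → ℝ) → ℝ) (x₀ : ι → ℝ)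
    (c : (ι →₀ ℕ) → ℝ) (v : ι → ℝ) : Prop :=
  (∀ i, v i ≠ 0) ∧
  (Summable fun α : ι →₀ ℕ => |c α * monomial v α|) ∧
  ∀ h : ι → ℝ, (∀ i, |h i| ≤ |v i|) →
    x₀ + h ∈ D ∧ HasSum (fun α : ι →₀ ℕ => c α * monomial h α) (f (x₀ + h))

/-- `v` is near infinity in the topology `𝒯^p`. -/
def IsNearInfty {ι : Type*} (p : ℝ) (v : ι → ℝ) : Prop :=
  (∀ i, v i ≠ 0) ∧ Summable fun i => 1 / |v i| ^ p

/-- `f` is analytic at `x₀` and its monomial expansion is absolutely convergent at a point near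
infinity in the topology `𝒯^p`. As the convergence is absolute, it makes no difference whether
the convergence is required of the coefficients `c α` or of the majorant coefficients `|c α|`. -/
def AnalyticNearInfty {ι : Type*} (p : ℝ) (D : Set (ι → ℝ)) (f : (ι → ℝ) → ℝ)
    (x₀ : ι → ℝ) : Prop :=
  ∃ (c : (ι →₀ ℕ) → ℝ) (v : ι → ℝ), HasMonomialExpansion D f x₀ c v ∧ IsNearInfty p v

/-- The partial derivative in the `i`-th coordinate. -/
def partialDeriv (i : ℕ) (u : (ℕ → ℝ) → ℝ) : (ℕ → ℝ) → ℝ :=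
  fun z => deriv (fun s : ℝ => u (Function.update z i s)) (z i)

/-- `∂_{e 0}^{β 0} ∂_{e 1}^{β 1} ⋯ ∂_{e n}^{β n} u`, where `n` is the largest index in the support
of `β` and `e` says which coordinate of the argument of `u` the `i`-th entry of `β` refers to. -/
def multiPartial (e : ℕ → ℕ) (β : ℕ →₀ ℕ) (u : (ℕ → ℝ) → ℝ) : (ℕ → ℝ) → ℝ :=
  (List.range (β.support.sup id + 1)).foldr (fun i g => (partialDeriv (e i))^[β i] g) u

/-- The index set of the derivatives `∂_x^β ∂_t^j u` on the right-hand side of the equation. -/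
def DerIndex (m : ℕ) : Type :=
  {b : (ℕ →₀ ℕ) × ℕ // b.2 < m ∧ 1 ≤ b.1.degree + b.2 ∧ b.1.degree + b.2 ≤ m}

/-- The index set of the coordinates of `ℝ × ℝ^ℕ × ℝ × ℝ^(DerIndex m)`, the space of the
arguments `(t, x, u, w)` of the right-hand side `f`. -/
inductive JetIndex (m : ℕ) : Type
  | time : JetIndex m
  | space : ℕ → JetIndex m
  | value : JetIndex m
  | der : DerIndex m → JetIndex m

/-- `(t, x, u, (∂_x^β ∂_t^j u)_(β, j))` at the point `z = (t, x)`, where `t = z 0` and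
`x i = z (i + 1)`. -/
def jet (m : ℕ) (u : (ℕ → ℝ) → ℝ) (z : ℕ → ℝ) : JetIndex m → ℝ
  | .time => z 0
  | .space i => z (i + 1)
  | .value => u z
  | .der b => multiPartial Nat.succ b.1.1 ((partialDeriv 0)^[b.1.2] u) z

/-- The point `(0, 0, φ_0 (0), (∂_x^β φ_j (0))_(β, j))` determined by the initial data. -/
def jetCenter (m : ℕ) (φ : ℕ → (ℕ → ℝ) → ℝ) : JetIndex m → ℝ
  | .time => 0
  | .space _ => 0
  | .value => φ 0 0
  | .der b => multiPartial id b.1.1 (φ b.1.2) 0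

/-- The open ball of radius `r` about `0` of `ℓ^q`, as a subset of the space of all sequences. -/
def lpBall (q : ℝ≥0∞) [Fact (1 ≤ q)] (r : ℝ) : Set (ℕ → ℝ) :=
  (fun y : lp (fun _ : ℕ => ℝ) q => (y : ℕ → ℝ)) '' Metric.ball 0 r

/-- `u` is, on the ball of radius `r > 0` of `ℓ^q` in the variables `(t, x)`, a solution of
`∂_t^m u = f (t, x, u, (∂_x^β ∂_t^j u)_(β, j))`, `∂_t^k u (0, x) = φ_k (x)` for `k < m`, which is
analytic at `0` and is represented by its monomial expansion on the whole ball. Here `D` is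
the domain of `f` and `E k` the domain of `φ k`; only the `φ k` with `k < m` matter. -/
structure IsLocalAnalyticSolution (m : ℕ) (q : ℝ≥0∞) [Fact (1 ≤ q)]
    (D : Set (JetIndex m → ℝ)) (f : (JetIndex m → ℝ) → ℝ)
    (E : ℕ → Set (ℕ → ℝ)) (φ : ℕ → (ℕ → ℝ) → ℝ) (r : ℝ) (u : (ℕ → ℝ) → ℝ) : Prop where
  pos : 0 < r
  analytic : ∃ c : (ℕ →₀ ℕ) → ℝ,
    (∃ v : ℕ → ℝ, HasMonomialExpansion (lpBall q r) u 0 c v) ∧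
    ∀ z ∈ lpBall q r, HasSum (fun α : ℕ →₀ ℕ => c α * monomial z α) (u z)
  /-- All partial derivatives of order at most `m` exist. -/
  differentiable : ∀ l : List ℕ, l.length < m → ∀ i : ℕ, ∀ z ∈ lpBall q r,
    DifferentiableAt ℝ (fun s : ℝ => (l.foldr partialDeriv u) (Function.update z i s)) (z i)
  equation : ∀ z ∈ lpBall q r,
    jet m u z ∈ D ∧ (partialDeriv 0)^[m] u z = f (jet m u z)
  initial : ∀ k < m, ∀ z ∈ lpBall q r, z 0 = 0 →
    (fun i => z (i + 1)) ∈ E k ∧ (partialDeriv 0)^[k] u z = φ k (fun i => z (i + 1))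

end InfCK

end

/-!
A power series in `(t, x)` is handled through its family of coefficients `c : (ℕ →₀ ℕ) → ℝ` and
its majorant `majorant c z = ∑ |c α z ^ α|`. `Represents S c u` says that `u` is the sum of the
series on `S`; such sums may be differentiated term by term (`Represents.foldr`), and they
determine their coefficients (`Represents.unique`).

*Existence.* Let `D 0` be the formal `∂_t` and `J` its right inverse, the primitive that vanishes for
`t = 0`. In terms of `W = ∂_t ^ m u` one has `u = P + J ^ m W`, where `P` is a polynomial in `t` formed
from the initial data, and the Cauchy problem becomes the fixed point equation
`W = f (jet (P + J ^ m W))`. It is solved in the Banach algebra `WeightedSeries ω` of the series with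
`∑ |c α| ω ^ α α! / |α|! < ∞`. The factor `α! / |α|!` serves three purposes: the weight is
submultiplicative (`weight_add_le`), so that the norm is an algebra norm; evaluation at `z` is bounded
as soon as `∑ |z i| / ω i ≤ 1` (`abs_monomial_le_weight`), which by Hölder's inequality holds on a ball
of `ℓ^q` when `∑ ω i ^ (-p) < ∞` (`exists_lpBall_admissible`); and `∂_{x_i} J` is bounded with norm
at most `ω 0 / ω (i + 1)` (`wnorm_D_J_le`). As every entry of the jet contains at most `m`
derivatives and fewer than `m` derivatives in `t`, a small weight `ω 0` of `t` makes the dependence of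
the jet on `W` weak, and the right-hand side is a contraction (`exists_eq_tsum_prod_pow`).

*Uniqueness.* By Baire's theorem a majorant which is finite on a ball of `ℓ^q` is bounded on a
smaller one (`exists_majorant_le`), and by Cauchy's estimates so are the majorants of the
derivatives. Hence near `0` the jets of two solutions remain in a region where `f` is Lipschitz. If the
difference of the solutions is of order `l + m` in `t`, then the jets differ by `O(t ^ (l + 1))`, so by
the equation the `m`-th derivatives in `t` differ by `O(t ^ (l + 1))`, and the difference is of order
`l + 1 + m` (`VanishesBelow.D_iterate_of_lipschitz`). As both solutions have the same initial
data, this induction starts, and all coefficients of the difference vanish.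

*Regularity.* The first and second order Taylor estimates for a monomial can be bounded by the
monomial itself at a point with larger coordinates (`exists_linear_part`). Summed against the bounded
majorant, they give a second order Taylor estimate which is uniform on a ball, and this implies
continuous differentiability (`continuousOn_fderiv_of_taylor`).
-/

noncomputable section

namespace InfCK

open Finsupp Filter Topology

/-! ### Monomials -/

/-- Induction on a multi-index, raising one exponent by one at a time. -/
theorem finsupp_induction_add_single {ι : Type*} {P : (ι →₀ ℕ) → Prop} (h0 : P 0)
    (h1 : ∀ α i, P α → P (α + single i 1)) (α : ι →₀ ℕ) : P α := by
  classical
  obtain ⟨s, rfl⟩ := (Finsupp.orderIsoMultiset (ι := ι)).symm.surjective α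
  induction s using Multiset.induction with
  | empty => simpa using h0
  | cons a s ih =>
    have := h1 _ a ih
    convert this using 1
    apply (Finsupp.orderIsoMultiset (ι := ι)).injective
    simp [Finsupp.coe_orderIsoMultiset, add_comm, ← Multiset.singleton_add]

theorem prod_pow_add_single {ι R : Type*} [CommMonoid R] (h : ι → R) (α : ι →₀ ℕ) (i : ι) :
    (α + single i 1).prod (fun j k => h j ^ k) = α.prod (fun j k => h j ^ k) * h i := by
  classical
  rw [Finsupp.prod_add_index' (by simp) (by intros; exact pow_add _ _ _)]
  simp

theorem monomial_zero {ι : Type*} (h : ι → ℝ) : monomial h 0 = 1 := by simp [monomial]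

theorem monomial_add_single {ι : Type*} (h : ι → ℝ) (α : ι →₀ ℕ) (i : ι) :
    monomial h (α + single i 1) = monomial h α * h i := prod_pow_add_single h α i

theorem monomial_add {ι : Type*} (h : ι → ℝ) (α β : ι →₀ ℕ) :
    monomial h (α + β) = monomial h α * monomial h β := by
  classical
  exact Finsupp.prod_add_index' (by simp) (by intros; exact pow_add _ _ _)

theorem monomial_nonneg {ι : Type*} {h : ι → ℝ} (hh : ∀ i, 0 ≤ h i) (α : ι →₀ ℕ) :
    0 ≤ monomial h α := Finset.prod_nonneg fun i _ => pow_nonneg (hh i) _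

theorem monomial_pos {ι : Type*} {h : ι → ℝ} (hh : ∀ i, 0 < h i) (α : ι →₀ ℕ) :
    0 < monomial h α := Finset.prod_pos fun i _ => pow_pos (hh i) _

theorem abs_monomial {ι : Type*} (h : ι → ℝ) (α : ι →₀ ℕ) :
    |monomial h α| = monomial (fun i => |h i|) α := by
  simp [monomial, Finsupp.prod, Finset.abs_prod, abs_pow]

theorem abs_monomial_mono {ι : Type*} {y z : ι → ℝ} (h : ∀ i, |y i| ≤ |z i|) (α : ι →₀ ℕ) :
    |monomial y α| ≤ |monomial z α| := by
  rw [abs_monomial, abs_monomial]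
  exact Finset.prod_le_prod (fun i _ => by positivity)
    fun i _ => pow_le_pow_left₀ (abs_nonneg _) (h i) _

theorem monomial_zero_left {ι : Type*} {α : ι →₀ ℕ} (h : α ≠ 0) :
    monomial (0 : ι → ℝ) α = 0 := by
  obtain ⟨i, hi⟩ := Finsupp.ne_iff.1 h
  exact Finset.prod_eq_zero (i := i) (by simpa using hi) (by simpa using hi)

theorem monomial_smul {ι : Type*} (l : ℝ) (h : ι → ℝ) (α : ι →₀ ℕ) :
    monomial (l • h) α = l ^ α.degree * monomial h α := by
  simp [monomial, Finsupp.prod, mul_pow, Finset.prod_mul_distrib, Finset.prod_pow_eq_pow_sum,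
    Finsupp.degree_apply]

theorem monomial_eq_erase {ι : Type*} (h : ι → ℝ) (α : ι →₀ ℕ) (i : ι) :
    monomial h α = h i ^ α i * monomial h (α.erase i) := by
  classical
  conv_lhs => rw [← Finsupp.erase_add_single i α, monomial_add]
  rw [mul_comm]; simp [monomial]

theorem monomial_update_erase {ι : Type*} [DecidableEq ι] (h : ι → ℝ) (α : ι →₀ ℕ) (i : ι)
    (s : ℝ) : monomial (Function.update h i s) (α.erase i) = monomial h (α.erase i) := by
  refine Finset.prod_congr rfl fun j hj => ?_
  have : j ≠ i := by rintro rfl; simp at hj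
  simp [this]

theorem monomial_update {ι : Type*} [DecidableEq ι] (h : ι → ℝ) (α : ι →₀ ℕ) (i : ι) (s : ℝ) :
    monomial (Function.update h i s) α = s ^ α i * monomial h (α.erase i) := by
  rw [monomial_eq_erase _ α i, monomial_update_erase]; simp

/-! ### Formal derivatives and majorants -/

/-- The formal partial derivative in the `i`-th variable of a family of coefficients. -/
def D (i : ℕ) (c : (ℕ →₀ ℕ) → ℝ) : (ℕ →₀ ℕ) → ℝ :=
  fun α => (α i + 1) * c (α + single i 1)

/-- The formal partial derivative along a list of variables. -/
def DL (L : List ℕ) (c : (ℕ →₀ ℕ) → ℝ) : (ℕ →₀ ℕ) → ℝ := L.foldr D c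

/-- The value `∑ |c α z ^ α|` at `z` of the majorant of the series with coefficients `c`. -/
def majorant (c : (ℕ →₀ ℕ) → ℝ) (z : ℕ → ℝ) : ℝ≥0∞ := ∑' α, ‖c α * monomial z α‖ₑ

theorem D_comm (i j : ℕ) (c : (ℕ →₀ ℕ) → ℝ) : D i (D j c) = D j (D i c) := by
  funext α
  rcases eq_or_ne i j with rfl | h
  · rfl
  · simp [D, h, h.symm, add_right_comm]; ring

theorem D_add (i : ℕ) (c d : (ℕ →₀ ℕ) → ℝ) : D i (c + d) = D i c + D i d := by
  funext α; simp [D]; ring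

theorem D_sub (i : ℕ) (c d : (ℕ →₀ ℕ) → ℝ) : D i (c - d) = D i c - D i d := by
  funext α; simp [D]; ring

theorem DL_cons (i : ℕ) (L : List ℕ) (c : (ℕ →₀ ℕ) → ℝ) : DL (i :: L) c = D i (DL L c) := rfl

theorem DL_append (L L' : List ℕ) (c : (ℕ →₀ ℕ) → ℝ) : DL (L ++ L') c = DL L (DL L' c) := by
  simp [DL]

theorem DL_replicate (i n : ℕ) (c : (ℕ →₀ ℕ) → ℝ) : DL (List.replicate n i) c = (D i)^[n] c := by
  induction n with
  | zero => rfl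
  | succ n ih => rw [List.replicate_succ, DL_cons, ih, Function.iterate_succ_apply']

theorem D_DL (i : ℕ) (L : List ℕ) (c : (ℕ →₀ ℕ) → ℝ) : D i (DL L c) = DL L (D i c) := by
  induction L with
  | nil => rfl
  | cons j L ih => rw [DL_cons, DL_cons, D_comm, ih]

theorem DL_add (L : List ℕ) (c d : (ℕ →₀ ℕ) → ℝ) : DL L (c + d) = DL L c + DL L d := by
  induction L with
  | nil => rfl
  | cons j L ih => simp only [DL_cons, ih, D_add]

theorem DL_sub (L : List ℕ) (c d : (ℕ →₀ ℕ) → ℝ) : DL L (c - d) = DL L c - DL L d := by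
  induction L with
  | nil => rfl
  | cons j L ih => simp only [DL_cons, ih, D_sub]

theorem summable_iff_majorant {c : (ℕ →₀ ℕ) → ℝ} {z : ℕ → ℝ} :
    (Summable fun α => c α * monomial z α) ↔ majorant c z ≠ ⊤ := by
  rw [← summable_norm_iff]; exact tsum_enorm_ne_top_iff_summable_norm.symm

theorem abs_tsum_le_majorant {c : (ℕ →₀ ℕ) → ℝ} {z : ℕ → ℝ} (h : majorant c z ≠ ⊤) :
    |∑' α, c α * monomial z α| ≤ (majorant c z).toReal := by
  have hs := summable_iff_majorant.2 h
  have h1 : ‖∑' α, c α * monomial z α‖ₑ ≤ majorant c z := by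
    exact enorm_tsum_le_tsum_enorm
  have := ENNReal.toReal_mono h h1
  simpa using this

theorem majorant_mono {c : (ℕ →₀ ℕ) → ℝ} {y z : ℕ → ℝ} (h : ∀ i, |y i| ≤ |z i|) :
    majorant c y ≤ majorant c z := by
  refine ENNReal.tsum_le_tsum fun α => ?_
  rw [enorm_mul, enorm_mul]
  gcongr
  rw [enorm_le_iff_norm_le]
  exact abs_monomial_mono h α

theorem majorant_add_le (c d : (ℕ →₀ ℕ) → ℝ) (z : ℕ → ℝ) :
    majorant (c + d) z ≤ majorant c z + majorant d z := by
  rw [majorant, majorant, majorant, ← ENNReal.tsum_add]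
  refine ENNReal.tsum_le_tsum fun α => ?_
  rw [Pi.add_apply, add_mul]; exact enorm_add_le _ _

theorem majorant_sub_le (c d : (ℕ →₀ ℕ) → ℝ) (z : ℕ → ℝ) :
    majorant (c - d) z ≤ majorant c z + majorant d z := by
  rw [majorant, majorant, majorant, ← ENNReal.tsum_add]
  refine ENNReal.tsum_le_tsum fun α => ?_
  rw [Pi.sub_apply, sub_mul]; exact enorm_sub_le

/-- Scaling the variables down shrinks the majorant of a series without constant term. -/
theorem majorant_smul_le {c : (ℕ →₀ ℕ) → ℝ} (hc : c 0 = 0) {l : ℝ} (h0 : 0 ≤ l) (h1 : l ≤ 1)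
    (z : ℕ → ℝ) : majorant c (l • z) ≤ ENNReal.ofReal l * majorant c z := by
  rw [majorant, majorant, ← ENNReal.tsum_mul_left]
  refine ENNReal.tsum_le_tsum fun α => ?_
  rcases eq_or_ne α 0 with rfl | hα
  · simp [hc]
  · rw [monomial_smul, ← Real.enorm_of_nonneg h0, ← enorm_mul, enorm_le_iff_norm_le]
    rw [mul_left_comm, norm_mul, norm_mul l]
    gcongr
    rw [Real.norm_of_nonneg (by positivity), Real.norm_of_nonneg h0]
    exact pow_le_of_le_one h0 h1 (by simpa [Finsupp.degree_eq_zero_iff] using hα)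

/-- The elementary inequality behind Cauchy's estimates. -/
theorem succ_mul_pow_le {a η : ℝ} (ha : 0 ≤ a) (hη : 0 ≤ η) (n : ℕ) :
    (n + 1) * η * a ^ n ≤ (a + η) ^ (n + 1) := by
  induction n with
  | zero => simpa using ha
  | succ n ih =>
    have h1 : η * a ^ (n + 1) ≤ η * (a + η) ^ (n + 1) := by gcongr; linarith
    have h2 := mul_le_mul_of_nonneg_left ih ha
    push_cast
    calc ((n : ℝ) + 1 + 1) * η * a ^ (n + 1) = a * ((n + 1) * η * a ^ n) + η * a ^ (n + 1) := by ring
      _ ≤ a * (a + η) ^ (n + 1) + η * (a + η) ^ (n + 1) := by linarith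
      _ = _ := by ring

/-- Cauchy's estimate for a single derivative, on the level of majorants. -/
theorem majorant_D_le (c : (ℕ →₀ ℕ) → ℝ) {η : ℝ} (hη : 0 ≤ η) {y z : ℕ → ℝ} {i : ℕ}
    (hi : |z i| + η ≤ |y i|) (h : ∀ j, |z j| ≤ |y j|) :
    ENNReal.ofReal η * majorant (D i c) z ≤ majorant c y := by
  rw [majorant, majorant, ← ENNReal.tsum_mul_left]
  refine le_trans ?_ (ENNReal.tsum_comp_le_tsum_of_injective
    (add_left_injective (single i 1 : ℕ →₀ ℕ)) _)
  refine ENNReal.tsum_le_tsum fun α => ?_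
  rw [← Real.enorm_of_nonneg hη, ← enorm_mul, enorm_le_iff_norm_le]
  have e : (α + single i 1).erase i = α.erase i := by ext j; by_cases hj : j = i <;> simp [hj]
  simp only [D, norm_mul, Real.norm_eq_abs]
  rw [monomial_eq_erase _ α i, monomial_eq_erase _ (α + single i 1) i, e]
  have h1 : (α i + 1) * η * |z i| ^ α i ≤ |y i| ^ (α i + 1) :=
    (succ_mul_pow_le (abs_nonneg _) hη _).trans (pow_le_pow_left₀ (by positivity) hi _)
  have h2 := abs_monomial_mono h (α.erase i)
  have h3 := mul_le_mul h1 h2 (abs_nonneg _) (by positivity)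
  have h4 := mul_le_mul_of_nonneg_left h3 (abs_nonneg (c (α + single i 1)))
  rw [abs_mul, abs_mul, abs_pow, abs_pow, abs_of_nonneg hη,
    abs_of_nonneg (by positivity : (0:ℝ) ≤ α i + 1)]
  simp only [Finsupp.add_apply, single_eq_same]
  linarith

/-- Cauchy's estimate for an iterated derivative, on the level of majorants. -/
theorem majorant_DL_le (c : (ℕ →₀ ℕ) → ℝ) {η : ℝ} (hη : 0 ≤ η) {y : ℕ → ℝ} (L : List ℕ)
    {z : ℕ → ℝ} (h : ∀ j, |z j| + η * L.count j ≤ |y j|) :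
    ENNReal.ofReal η ^ L.length * majorant (DL L c) z ≤ majorant c y := by
  induction L generalizing z with
  | nil => simpa [DL] using majorant_mono (by simpa using h)
  | cons i L ih =>
    have hz : ∀ j, |(fun j => |z j| + if j = i then η else 0) j|
        = |z j| + if j = i then η else 0 := fun j =>
      abs_of_nonneg (by dsimp only; split_ifs <;> positivity)
    refine le_trans ?_ (ih (z := fun j => |z j| + if j = i then η else 0) fun j => ?_)
    · rw [List.length_cons, pow_succ, mul_assoc, DL_cons]
      gcongr
      refine majorant_D_le _ hη ?_ fun j => ?_
      · rw [hz]; simp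
      · rw [hz]; split_ifs <;> simp [hη]
    · rw [hz]
      refine le_trans (le_of_eq ?_) (h j)
      rw [List.count_cons]
      by_cases hj : i = j
      · simp [hj]; ring
      · simp [hj, Ne.symm hj]

theorem majorant_DL_le_of_length_le (c : (ℕ →₀ ℕ) → ℝ) {η : ℝ} (h0 : 0 < η) (h1 : η ≤ 1) {n : ℕ}
    {L : List ℕ} (hL : L.length ≤ n) {y z : ℕ → ℝ} (h : ∀ j, |z j| + η * L.count j ≤ |y j|) :
    majorant (DL L c) z ≤ (ENNReal.ofReal (η ^ n))⁻¹ * majorant c y := by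
  have h2 : ENNReal.ofReal (η ^ n) ≤ ENNReal.ofReal η ^ L.length := by
    rw [← ENNReal.ofReal_pow h0.le]
    exact ENNReal.ofReal_le_ofReal (pow_le_pow_of_le_one h0.le h1 hL)
  rw [← ENNReal.div_eq_inv_mul,
    ENNReal.le_div_iff_mul_le (Or.inl (by rw [Ne, ENNReal.ofReal_eq_zero, not_le]; positivity))
      (Or.inl ENNReal.ofReal_ne_top), mul_comm]
  exact (mul_le_mul_left h2 _).trans (majorant_DL_le c h0.le L h)

theorem exists_mul_natCast_le {μ : ℝ} (hμ : 0 < μ) (n : ℕ) : ∃ η : ℝ, 0 < η ∧ η ≤ 1 ∧ η * n ≤ μ := by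
  have hn : (0 : ℝ) ≤ n := n.cast_nonneg
  have h1 : min 1 μ / (n + 1) * (n + 1) = min 1 μ := div_mul_cancel₀ _ (by positivity)
  have h2 : 0 < min 1 μ / (n + 1 : ℝ) := by positivity
  have h3 : min 1 μ ≤ 1 := min_le_left _ _
  have h4 : min 1 μ ≤ μ := min_le_right _ _
  exact ⟨_, h2, by nlinarith, by nlinarith⟩

theorem majorant_sub_const_le (c : (ℕ →₀ ℕ) → ℝ) (z : ℕ → ℝ) :
    majorant (c - fun α => if α = 0 then c 0 else 0) z ≤ majorant c z := by
  refine ENNReal.tsum_le_tsum fun α => ?_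
  by_cases hα : α = 0 <;> simp [hα]

/-! ### Functions represented by power series -/

/-- A set of sequences from whose points every coordinate may be replaced by any number of
slightly larger absolute value. -/
def CoordOpen (S : Set (ℕ → ℝ)) : Prop :=
  ∀ z ∈ S, ∀ i, ∃ δ > 0, ∀ s : ℝ, |s| ≤ |z i| + δ → Function.update z i s ∈ S

/-- `u` is on `S` the sum of the series with coefficients `c`. -/
def Represents (S : Set (ℕ → ℝ)) (c : (ℕ →₀ ℕ) → ℝ) (u : (ℕ → ℝ) → ℝ) : Prop :=
  ∀ z ∈ S, HasSum (fun α => c α * monomial z α) (u z)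

theorem CoordOpen.inter {S T : Set (ℕ → ℝ)} (hS : CoordOpen S) (hT : CoordOpen T) :
    CoordOpen (S ∩ T) := by
  intro z hz i
  obtain ⟨δ, h0, h⟩ := hS z hz.1 i
  obtain ⟨δ', h0', h'⟩ := hT z hz.2 i
  refine ⟨min δ δ', lt_min h0 h0', fun s hs => ⟨h s (hs.trans ?_), h' s (hs.trans ?_)⟩⟩ <;>
  gcongr
  exacts [min_le_left _ _, min_le_right _ _]

theorem Represents.majorant_ne_top {S : Set (ℕ → ℝ)} {c : (ℕ →₀ ℕ) → ℝ} {u : (ℕ → ℝ) → ℝ}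
    (h : Represents S c u) {z : ℕ → ℝ} (hz : z ∈ S) : majorant c z ≠ ⊤ :=
  summable_iff_majorant.1 (h z hz).summable

theorem hasSum_const (a : ℝ) (z : ℕ → ℝ) :
    HasSum (fun α => (if α = 0 then a else 0) * monomial z α) a := by
  have := hasSum_single (f := fun α => (if α = 0 then a else 0) * monomial z α) 0
    (fun α hα => by simp [hα])
  simpa [monomial_zero] using this

theorem represents_of_majorant {S : Set (ℕ → ℝ)} {c : (ℕ →₀ ℕ) → ℝ}
    (h : ∀ z ∈ S, majorant c z ≠ ⊤) : Represents S c fun z => ∑' α, c α * monomial z α :=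
  fun z hz => (summable_iff_majorant.2 (h z hz)).hasSum

/-- A sum of monomials may be differentiated term by term in each coordinate. -/
theorem Represents.hasDerivAt {S : Set (ℕ → ℝ)} (hS : CoordOpen S) {c : (ℕ →₀ ℕ) → ℝ}
    {u : (ℕ → ℝ) → ℝ} (h : Represents S c u) {z : ℕ → ℝ} (hz : z ∈ S) (i : ℕ) :
    (Summable fun α => D i c α * monomial z α) ∧
      HasDerivAt (fun s => u (Function.update z i s)) (∑' α, D i c α * monomial z α) (z i) := by
  obtain ⟨δ, hδ, hS'⟩ := hS z hz i
  have hy := hS' (|z i| + δ) (by rw [abs_of_nonneg (by positivity)])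
  set y := Function.update z i (|z i| + δ) with hydef
  have hA : majorant (D i c) z ≠ ⊤ := by
    intro htop
    have := majorant_D_le c hδ.le (y := y) (z := z) (i := i)
      (by simp [hydef, abs_of_nonneg (by positivity : 0 ≤ |z i| + δ)])
      (fun j => by
        by_cases hj : j = i
        · subst hj; simp [hydef, abs_of_nonneg (by positivity : 0 ≤ |z j| + δ), hδ.le]
        · simp [hydef, hj])
    rw [htop, ENNReal.mul_top (by simpa using hδ)] at this
    exact h.majorant_ne_top hy (top_le_iff.1 this)
  refine ⟨summable_iff_majorant.2 hA, ?_⟩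
  have hsum : Summable fun α => (2 / δ) * |c α * monomial y α| := (h y hy).summable.abs.mul_left _
  have key := hasDerivAt_tsum_of_isPreconnected (𝕜 := ℝ) (y₀ := z i) (y := z i) hsum
    (t := Metric.ball 0 (|z i| + δ / 2))
    (g := fun α s => c α * (s ^ α i * monomial z (α.erase i)))
    (g' := fun α s => c α * ((α i * s ^ (α i - 1)) * monomial z (α.erase i)))
    Metric.isOpen_ball (convex_ball _ _).isPreconnected
    (fun α s _ => ((hasDerivAt_pow (α i) s).mul_const _).const_mul _)
    (fun α s hs => by
      rw [mem_ball_zero_iff, Real.norm_eq_abs] at hs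
      rw [hydef, monomial_update, norm_mul, norm_mul, Real.norm_eq_abs, Real.norm_eq_abs,
        Real.norm_eq_abs, abs_mul (c α), abs_mul _ (monomial z _)]
      have h1 : |(α i * s ^ (α i - 1) : ℝ)| ≤ 2 / δ * |(|z i| + δ) ^ α i| := by
        rw [abs_mul, abs_pow, abs_pow, abs_of_nonneg (by positivity : 0 ≤ |z i| + δ), Nat.abs_cast]
        rcases Nat.eq_zero_or_pos (α i) with h0 | h0
        · simp [h0]; positivity
        · obtain ⟨n, hn⟩ := Nat.exists_eq_succ_of_ne_zero h0.ne'
          rw [hn]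
          have h2 := succ_mul_pow_le (abs_nonneg s) (by positivity : 0 ≤ δ / 2) n
          have h3 : (|s| + δ / 2) ^ (n + 1) ≤ (|z i| + δ) ^ (n + 1) := by
            gcongr ?_ ^ _; linarith
          simp only [Nat.succ_eq_add_one, Nat.add_sub_cancel]
          push_cast
          rw [div_mul_eq_mul_div, le_div_iff₀ hδ]
          linarith
      calc _ ≤ |c α| * ((2 / δ * |(|z i| + δ) ^ α i|) * |monomial z (α.erase i)|) := by gcongr
        _ = _ := by ring)
    (by rw [mem_ball_zero_iff, Real.norm_eq_abs]; linarith)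
    (by
      have := (h z hz).summable
      refine this.congr fun α => ?_
      rw [monomial_eq_erase z α i])
    (by rw [mem_ball_zero_iff, Real.norm_eq_abs]; linarith)
  have e : ∑' α, D i c α * monomial z α
      = ∑' α, c α * ((α i * z i ^ (α i - 1)) * monomial z (α.erase i)) := by
    symm
    rw [← Function.Injective.tsum_eq (add_left_injective (single i 1 : ℕ →₀ ℕ))]
    · refine tsum_congr fun α => ?_
      have e : (α + single i 1).erase i = α.erase i := by ext j; by_cases hj : j = i <;> simp [hj]
      simp only [D]
      rw [e, monomial_eq_erase z α i]
      simp; ring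
    · intro α hα
      have : α i ≠ 0 := by rintro h0; simp [h0] at hα
      refine ⟨α - single i 1, tsub_add_cancel_of_le ?_⟩
      simpa [Finsupp.single_le_iff, Nat.one_le_iff_ne_zero] using this
  rw [e]
  refine key.congr_of_eventuallyEq ?_
  have : Metric.ball (0 : ℝ) (|z i| + δ) ∈ 𝓝 (z i) :=
    Metric.isOpen_ball.mem_nhds (by rw [mem_ball_zero_iff, Real.norm_eq_abs]; linarith)
  filter_upwards [this] with s hs
  rw [mem_ball_zero_iff, Real.norm_eq_abs] at hs
  rw [← (h _ (hS' s hs.le)).tsum_eq]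
  exact tsum_congr fun α => by rw [monomial_update]

theorem Represents.partialDeriv {S : Set (ℕ → ℝ)} (hS : CoordOpen S) {c : (ℕ →₀ ℕ) → ℝ}
    {u : (ℕ → ℝ) → ℝ} (h : Represents S c u) (i : ℕ) :
    Represents S (D i c) (partialDeriv i u) := by
  intro z hz
  obtain ⟨h1, h2⟩ := h.hasDerivAt hS hz i
  rw [InfCK.partialDeriv, h2.deriv]
  exact h1.hasSum

theorem Represents.foldr {S : Set (ℕ → ℝ)} (hS : CoordOpen S) {c : (ℕ →₀ ℕ) → ℝ}
    {u : (ℕ → ℝ) → ℝ} (h : Represents S c u) (L : List ℕ) :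
    Represents S (DL L c) (L.foldr InfCK.partialDeriv u) := by
  induction L with
  | nil => exact h
  | cons i L ih => exact ih.partialDeriv hS i

theorem foldr_replicate {α β : Type*} (f : α → β → β) (n : ℕ) (a : α) (b : β) :
    (List.replicate n a).foldr f b = (f a)^[n] b := by
  induction n with
  | zero => rfl
  | succ n ih => rw [List.replicate_succ, List.foldr_cons, ih, Function.iterate_succ_apply']

theorem Represents.iterate {S : Set (ℕ → ℝ)} (hS : CoordOpen S) {c : (ℕ →₀ ℕ) → ℝ}
    {u : (ℕ → ℝ) → ℝ} (h : Represents S c u) (i n : ℕ) :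
    Represents S ((D i)^[n] c) ((InfCK.partialDeriv i)^[n] u) := by
  simpa [DL_replicate, foldr_replicate] using h.foldr hS (List.replicate n i)

theorem Represents.apply_zero {S : Set (ℕ → ℝ)} (h0 : (0 : ℕ → ℝ) ∈ S) {c : (ℕ →₀ ℕ) → ℝ}
    {u : (ℕ → ℝ) → ℝ} (h : Represents S c u) : u 0 = c 0 := by
  have := hasSum_single (f := fun α => c α * monomial (0 : ℕ → ℝ) α) 0
    (fun α hα => by simp [monomial_zero_left hα])
  simpa [monomial_zero] using (h 0 h0).unique this

/-- The coefficients of a convergent series are determined by its sum. -/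
theorem Represents.unique {S : Set (ℕ → ℝ)} (hS : CoordOpen S) (h0 : (0 : ℕ → ℝ) ∈ S)
    {c d : (ℕ →₀ ℕ) → ℝ} {u : (ℕ → ℝ) → ℝ} (hc : Represents S c u) (hd : Represents S d u) :
    c = d := by
  funext α
  induction α using finsupp_induction_add_single generalizing c d u with
  | h0 => rw [← hc.apply_zero h0, hd.apply_zero h0]
  | h1 α i ih =>
    have := ih (hc.partialDeriv hS i) (hd.partialDeriv hS i)
    exact mul_left_cancel₀ (by positivity) this

theorem Represents.mono {S T : Set (ℕ → ℝ)} {c : (ℕ →₀ ℕ) → ℝ} {u : (ℕ → ℝ) → ℝ}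
    (h : Represents S c u) (hT : T ⊆ S) : Represents T c u := fun z hz => h z (hT hz)

/-- The list of the variables, with repetitions, in which `multiPartial e β` differentiates. -/
def derList (e : ℕ → ℕ) (β : ℕ →₀ ℕ) : List ℕ :=
  (List.range (β.support.sup id + 1)).flatMap fun i => List.replicate (β i) (e i)

theorem multiPartial_eq_foldr (e : ℕ → ℕ) (β : ℕ →₀ ℕ) (u : (ℕ → ℝ) → ℝ) :
    multiPartial e β u = (derList e β).foldr partialDeriv u := by
  unfold multiPartial derList
  induction List.range (β.support.sup id + 1) with
  | nil => rfl
  | cons i l ih =>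
    rw [List.foldr_cons, List.flatMap_cons, List.foldr_append, ← ih, foldr_replicate]

theorem derList_length (e : ℕ → ℕ) (β : ℕ →₀ ℕ) : (derList e β).length = β.degree := by
  rw [derList, List.length_flatMap, Finsupp.degree_apply]
  simp only [List.length_replicate]
  rw [Finset.sum_subset (s₂ := Finset.range (β.support.sup id + 1)) (f := β)]
  · simp [Finset.sum, Multiset.range]
  · intro i hi
    simpa [Nat.lt_succ_iff] using Finset.le_sup (f := id) hi
  · intro i _ hi
    simpa using hi

theorem derList_succ (β : ℕ →₀ ℕ) : derList Nat.succ β = (derList id β).map Nat.succ := by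
  simp [derList, List.map_flatMap]

/-! ### A weighted algebra of power series in infinitely many variables -/

theorem choose_mul_choose_le (a b c d : ℕ) :
    a.choose b * c.choose d ≤ (a + c).choose (b + d) := by
  rw [Nat.add_choose_eq]
  exact Finset.single_le_sum (f := fun ij : ℕ × ℕ => a.choose ij.1 * c.choose ij.2)
    (fun _ _ => Nat.zero_le _) (a := (b, d)) (by simp)

theorem nat_multinomial_mul_le (s : Finset ℕ) (f g : ℕ → ℕ) :
    Nat.multinomial s f * Nat.multinomial s g ≤ Nat.multinomial s (f + g) := by
  classical
  induction s using Finset.induction with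
  | empty => simp
  | insert a s ha ih =>
    rw [Nat.multinomial_insert ha, Nat.multinomial_insert ha, Nat.multinomial_insert ha,
      mul_mul_mul_comm]
    refine Nat.mul_le_mul ((choose_mul_choose_le _ _ _ _).trans (le_of_eq ?_)) ih
    simp only [Pi.add_apply, Finset.sum_add_distrib]
    congr 1; ring

theorem multinomial_mul_le (α β : ℕ →₀ ℕ) :
    α.multinomial * β.multinomial ≤ (α + β).multinomial := by
  classical
  rw [multinomial_eq_of_support_subset (s := α.support ∪ β.support) Finset.subset_union_left,
    multinomial_eq_of_support_subset (f := β) (s := α.support ∪ β.support)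
      Finset.subset_union_right,
    multinomial_eq_of_support_subset (f := α + β) (s := α.support ∪ β.support)
      Finsupp.support_add]
  exact nat_multinomial_mul_le _ _ _

theorem multinomial_mul_prod_le (s : Finset ℕ) (f : ℕ → ℕ) {y : ℕ → ℝ} (hy : ∀ i, 0 ≤ y i) :
    (Nat.multinomial s f : ℝ) * ∏ i ∈ s, y i ^ f i ≤ (∑ i ∈ s, y i) ^ (∑ i ∈ s, f i) := by
  classical
  induction s using Finset.induction with
  | empty => simp
  | insert a s ha ih =>
    have hs : 0 ≤ ∑ i ∈ s, y i := Finset.sum_nonneg fun i _ => hy i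
    rw [Nat.multinomial_insert ha, Finset.prod_insert ha, Finset.sum_insert ha,
      Finset.sum_insert ha, add_pow]
    refine le_trans ?_ (Finset.single_le_sum (f := fun k => y a ^ k * (∑ i ∈ s, y i) ^
      (f a + ∑ i ∈ s, f i - k) * ((f a + ∑ i ∈ s, f i).choose k)) (fun k _ => ?_)
      (a := f a) (by simp))
    · rw [Nat.add_sub_cancel_left]
      push_cast
      have := mul_le_mul_of_nonneg_left ih (by have := hy a; positivity :
        0 ≤ ((f a + ∑ i ∈ s, f i).choose (f a) : ℝ) * y a ^ f a)
      linarith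
    · have := hy a
      positivity

theorem multinomial_add_single (β : ℕ →₀ ℕ) (i : ℕ) :
    (β + single i 1).multinomial * (β i + 1) = β.multinomial * (β.degree + 1) := by
  have hu : (β + single i 1).update i 0 = β.update i 0 := by
    ext j; by_cases hj : j = i <;> simp [hj]
  have h1 : ((β + single i 1).sum fun _ => id) = β.degree + 1 := by
    have : ((β + single i 1).sum fun _ => id) = (β + single i 1).degree := rfl
    rw [this, map_add]; simp
  have h2 : (β.sum fun _ => id) = β.degree := rfl
  rw [multinomial_update i (β + single i 1), multinomial_update i β, hu, h1, h2]
  have := Nat.add_one_mul_choose_eq β.degree (β i)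
  simp only [Finsupp.add_apply, single_eq_same]
  calc _ = ((β.degree + 1).choose (β i + 1) * (β i + 1)) * (β.update i 0).multinomial := by ring
    _ = _ := by rw [← this]; ring

/-- The weight `ω ^ α α! / |α|!` of the monomial `z ^ α` in the algebra `WeightedSeries ω`. Because
of the factor `α! / |α|!` it is still submultiplicative, it dominates `|z ^ α|` when
`∑ |z i| / ω i ≤ 1`, and raising one exponent by one changes it by the factor
`ω i (α i + 1) / (|α| + 1)`, whose denominator does not depend on `i`. -/
def weight (ω : ℕ → ℝ) (α : ℕ →₀ ℕ) : ℝ := monomial ω α / α.multinomial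

theorem multinomial_pos (α : ℕ →₀ ℕ) : 0 < α.multinomial := Nat.multinomial_pos _ _

theorem weight_pos {ω : ℕ → ℝ} (hω : ∀ i, 0 < ω i) (α : ℕ →₀ ℕ) : 0 < weight ω α :=
  div_pos (monomial_pos hω α) (by exact_mod_cast multinomial_pos α)

theorem weight_zero (ω : ℕ → ℝ) : weight ω 0 = 1 := by
  simp [weight, monomial_zero, multinomial_eq]

theorem weight_le_monomial {ω : ℕ → ℝ} (hω : ∀ i, 0 < ω i) (α : ℕ →₀ ℕ) :
    weight ω α ≤ monomial ω α :=
  div_le_self (monomial_pos hω α).le (by exact_mod_cast multinomial_pos α)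

theorem weight_add_le {ω : ℕ → ℝ} (hω : ∀ i, 0 < ω i) (α β : ℕ →₀ ℕ) :
    weight ω (α + β) ≤ weight ω α * weight ω β := by
  have h1 := multinomial_mul_le α β
  have h2 := multinomial_pos α
  have h3 := multinomial_pos β
  have h4 := monomial_pos hω (α + β)
  rw [weight, weight, weight, div_mul_div_comm, ← monomial_add]
  exact div_le_div_of_nonneg_left h4.le (by positivity) (by exact_mod_cast h1)

theorem weight_add_single {ω : ℕ → ℝ} (β : ℕ →₀ ℕ) (i : ℕ) :
    weight ω (β + single i 1) * (β.degree + 1) = ω i * (β i + 1) * weight ω β := by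
  have h := multinomial_add_single β i
  have h' : ((β + single i 1).multinomial : ℝ) * (β i + 1) = β.multinomial * (β.degree + 1) := by
    exact_mod_cast h
  have h2 : (0:ℝ) < (β + single i 1).multinomial := by exact_mod_cast multinomial_pos _
  have h3 : (0:ℝ) < β.multinomial := by exact_mod_cast multinomial_pos _
  rw [weight, weight, monomial_add_single]
  field_simp
  linear_combination (-(monomial ω β) * ω i) * h'

theorem weight_single {ω : ℕ → ℝ} (i : ℕ) : weight ω (single i 1) = ω i := by
  have := weight_add_single (ω := ω) 0 i
  simpa [weight_zero] using this

/-- The condition `∑ |z i| / ω i ≤ 1` on a point `z`, under which all series of `WeightedSeries ω`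
converge at `z`. -/
def Admissible (ω z : ℕ → ℝ) : Prop := ∀ s : Finset ℕ, ∑ i ∈ s, |z i| / ω i ≤ 1

theorem abs_monomial_le_weight {ω z : ℕ → ℝ} (hω : ∀ i, 0 < ω i) (hz : Admissible ω z)
    (α : ℕ →₀ ℕ) : |monomial z α| ≤ weight ω α := by
  have h0 : (0:ℝ) < α.multinomial := by exact_mod_cast multinomial_pos _
  have h := multinomial_mul_prod_le α.support α (y := fun i => |z i| / ω i)
    fun i => div_nonneg (abs_nonneg _) (hω i).le
  have h2 := h.trans (pow_le_one₀ (Finset.sum_nonneg fun i _ =>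
    div_nonneg (abs_nonneg _) (hω i).le) (hz _))
  have h3 : ∏ i ∈ α.support, (|z i| / ω i) ^ α i = |monomial z α| / monomial ω α := by
    simp only [div_pow, Finset.prod_div_distrib, abs_monomial]; rfl
  rw [h3] at h2
  have h4 := monomial_pos hω α
  rw [weight, le_div_iff₀ h0]
  rw [← mul_div_assoc, div_le_one h4, ← multinomial_eq] at h2
  rw [mul_comm]; exact h2

/-- The weighted `ℓ¹` norm of a family of coefficients, with the value `∞` allowed. -/
def wnorm (ω : ℕ → ℝ) (c : (ℕ →₀ ℕ) → ℝ) : ℝ≥0∞ := ∑' α, ‖c α * weight ω α‖ₑ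

theorem wnorm_add_le (ω : ℕ → ℝ) (c d : (ℕ →₀ ℕ) → ℝ) :
    wnorm ω (c + d) ≤ wnorm ω c + wnorm ω d := by
  rw [wnorm, wnorm, wnorm, ← ENNReal.tsum_add]
  refine ENNReal.tsum_le_tsum fun α => ?_
  rw [Pi.add_apply, add_mul]; exact enorm_add_le _ _

theorem wnorm_smul (ω : ℕ → ℝ) (a : ℝ) (c : (ℕ →₀ ℕ) → ℝ) :
    wnorm ω (a • c) = ‖a‖ₑ * wnorm ω c := by
  rw [wnorm, wnorm, ← ENNReal.tsum_mul_left]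
  refine tsum_congr fun α => ?_
  rw [Pi.smul_apply, smul_eq_mul, mul_assoc, enorm_mul]

theorem wnorm_neg (ω : ℕ → ℝ) (c : (ℕ →₀ ℕ) → ℝ) : wnorm ω (-c) = wnorm ω c := by
  simp [wnorm]

theorem wnorm_single (ω : ℕ → ℝ) (β : ℕ →₀ ℕ) (a : ℝ) :
    wnorm ω (fun α => if α = β then a else 0) = ‖a * weight ω β‖ₑ := by
  rw [wnorm, tsum_eq_single β]
  · simp
  · intro α hα; simp [hα]

theorem wnorm_le_majorant {ω : ℕ → ℝ} (hω : ∀ i, 0 < ω i) (c : (ℕ →₀ ℕ) → ℝ) :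
    wnorm ω c ≤ majorant c ω := by
  refine ENNReal.tsum_le_tsum fun α => ?_
  rw [enorm_mul, enorm_mul]
  gcongr
  rw [enorm_le_iff_norm_le, Real.norm_of_nonneg (weight_pos hω α).le,
    Real.norm_of_nonneg (monomial_pos hω α).le]
  exact weight_le_monomial hω α

theorem majorant_le_wnorm {ω z : ℕ → ℝ} (hω : ∀ i, 0 < ω i) (hz : Admissible ω z)
    (c : (ℕ →₀ ℕ) → ℝ) : majorant c z ≤ wnorm ω c := by
  refine ENNReal.tsum_le_tsum fun α => ?_
  rw [enorm_mul, enorm_mul]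
  gcongr
  rw [enorm_le_iff_norm_le, Real.norm_of_nonneg (weight_pos hω α).le]
  exact abs_monomial_le_weight hω hz α

open MvPowerSeries in
theorem wnorm_mul_le {ω : ℕ → ℝ} (hω : ∀ i, 0 < ω i) (a b : MvPowerSeries ℕ ℝ) :
    wnorm ω (fun α => coeff α (a * b))
      ≤ wnorm ω (fun α => coeff α a) * wnorm ω (fun α => coeff α b) := by
  have e : wnorm ω (fun α => coeff α a) * wnorm ω (fun α => coeff α b)
      = ∑' γ : ℕ →₀ ℕ, ∑ p ∈ Finset.HasAntidiagonal.antidiagonal γ,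
        ‖coeff p.1 a * weight ω p.1‖ₑ * ‖coeff p.2 b * weight ω p.2‖ₑ := by
    rw [wnorm, wnorm, ← ENNReal.tsum_mul_right]
    simp_rw [← ENNReal.tsum_mul_left]
    rw [← ENNReal.tsum_prod (f := fun x y =>
      ‖coeff x a * weight ω x‖ₑ * ‖coeff y b * weight ω y‖ₑ),
      ← Finset.HasAntidiagonal.sigmaAntidiagonalEquivProd.tsum_eq, ENNReal.tsum_sigma']
    refine tsum_congr fun γ => ?_
    rw [tsum_fintype, ← Finset.sum_coe_sort (Finset.HasAntidiagonal.antidiagonal γ)]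
    rfl
  rw [e]
  refine ENNReal.tsum_le_tsum fun γ => ?_
  beta_reduce
  rw [coeff_mul, Finset.sum_mul]
  refine (enorm_sum_le _ _).trans (Finset.sum_le_sum fun p hp => ?_)
  rw [← enorm_mul, enorm_le_iff_norm_le, norm_mul, norm_mul, norm_mul, norm_mul, norm_mul]
  rw [← Finset.HasAntidiagonal.mem_antidiagonal.1 hp, Real.norm_of_nonneg (weight_pos hω (p.1 + p.2)).le,
    Real.norm_of_nonneg (weight_pos hω p.1).le, Real.norm_of_nonneg (weight_pos hω p.2).le]
  have := mul_le_mul_of_nonneg_left (weight_add_le hω p.1 p.2)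
    (by positivity : 0 ≤ ‖coeff p.1 a‖ * ‖coeff p.2 b‖)
  linarith

theorem tsum_mul_tsum_monomial {c d : (ℕ →₀ ℕ) → ℝ} {z : ℕ → ℝ}
    (hc : Summable fun α => ‖c α * monomial z α‖) (hd : Summable fun α => ‖d α * monomial z α‖) :
    (∑' α, c α * monomial z α) * (∑' α, d α * monomial z α)
      = ∑' γ : ℕ →₀ ℕ, (∑ p ∈ Finset.HasAntidiagonal.antidiagonal γ, c p.1 * d p.2)
        * monomial z γ := by
  have h := summable_mul_of_summable_norm hc hd
  rw [Summable.tsum_mul_tsum_eq_tsum_sum_antidiagonal (A := ℕ →₀ ℕ) (α := ℝ)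
    (f := fun α => c α * monomial z α) (g := fun α => d α * monomial z α) hc.of_norm hd.of_norm h]
  refine tsum_congr fun γ => ?_
  rw [Finset.sum_mul]
  refine Finset.sum_congr rfl fun p hp => ?_
  rw [← Finset.HasAntidiagonal.mem_antidiagonal.1 hp, monomial_add]; ring

/-- The algebra of the formal power series in the variables `z i`, `i : ℕ`, whose weighted `ℓ¹`
norm is finite. The positivity of the weights `ω i` is part of their type, so that it is available
to the instances below. -/
def WeightedSeries (ω : ℕ → {x : ℝ // 0 < x}) : Subalgebra ℝ (MvPowerSeries ℕ ℝ) where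
  carrier := {a | wnorm (fun i => ω i) (fun α => MvPowerSeries.coeff α a) ≠ ⊤}
  mul_mem' {a b} ha hb := ne_top_of_le_ne_top (ENNReal.mul_ne_top ha hb)
    (wnorm_mul_le (fun i => (ω i).2) a b)
  add_mem' {a b} ha hb := ne_top_of_le_ne_top (ENNReal.add_ne_top.2 ⟨ha, hb⟩)
    (by simpa using! wnorm_add_le _ (fun α => MvPowerSeries.coeff α a) _)
  algebraMap_mem' r := by
    classical
    have := wnorm_single (fun i => ω i) 0 r
    simp only [Set.mem_ofPred_eq, MvPowerSeries.algebraMap_apply, MvPowerSeries.coeff_C]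
    simp [this, -enorm_mul]

variable {ω : ℕ → {x : ℝ // 0 < x}}

namespace WeightedSeries

/-- The coefficients of an element of the algebra. -/
def coeffs (a : WeightedSeries ω) : (ℕ →₀ ℕ) → ℝ := fun α => MvPowerSeries.coeff α a.1

/-- The element of the algebra with given coefficients. -/
def mk (c : (ℕ →₀ ℕ) → ℝ) (hc : wnorm (fun i => ω i) c ≠ ⊤) : WeightedSeries ω := ⟨c, hc⟩

@[simp] theorem coeffs_mk (c : (ℕ →₀ ℕ) → ℝ) (hc : wnorm (fun i => ω i) c ≠ ⊤) :
    coeffs (mk c hc : WeightedSeries ω) = c := rfl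

theorem wnorm_ne_top (a : WeightedSeries ω) : wnorm (fun i => ω i) (coeffs a) ≠ ⊤ := a.2

theorem coeffs_injective : Function.Injective (coeffs (ω := ω)) := by
  intro a b h
  exact Subtype.ext (MvPowerSeries.ext fun α => congrFun h α)

@[simp] theorem coeffs_add (a b : WeightedSeries ω) : coeffs (a + b) = (coeffs a) + (coeffs b) := by
  funext α; simp [coeffs]

@[simp] theorem coeffs_smul (r : ℝ) (b : WeightedSeries ω) : coeffs (r • b) = r • (coeffs b) := by
  funext α; simp [coeffs]

@[simp] theorem coeffs_neg (b : WeightedSeries ω) : coeffs (-b) = -(coeffs b) := by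
  funext α; simp [coeffs]

@[simp] theorem coeffs_zero : coeffs (0 : WeightedSeries ω) = 0 := by
  funext α; simp [coeffs]

theorem coeffs_mul (a b : WeightedSeries ω) (γ : ℕ →₀ ℕ) : coeffs (a * b) γ
    = ∑ p ∈ Finset.HasAntidiagonal.antidiagonal γ, coeffs a p.1 * coeffs b p.2 := by
  simp only [coeffs, MulMemClass.coe_mul]
  exact MvPowerSeries.coeff_mul (σ := ℕ) (R := ℝ) ..

theorem coeffs_one : coeffs (1 : WeightedSeries ω) = fun α => if α = 0 then 1 else 0 := by
  classical
  funext α; simp [coeffs, MvPowerSeries.coeff_one]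

/-- The norm is the weighted `ℓ¹` norm of the coefficients. -/
instance : NormedAddCommGroup (WeightedSeries ω) :=
  AddGroupNorm.toNormedAddCommGroup
    { toFun := fun a => (wnorm (fun i => ω i) (coeffs a)).toReal
      map_zero' := by simp [wnorm]
      add_le' := fun a b => by
        rw [← ENNReal.toReal_add (wnorm_ne_top a) (wnorm_ne_top b), coeffs_add]
        exact ENNReal.toReal_mono (ENNReal.add_ne_top.2 ⟨(wnorm_ne_top a), (wnorm_ne_top b)⟩)
          (wnorm_add_le _ _ _)
      neg' := fun a => by rw [coeffs_neg, wnorm_neg]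
      eq_zero_of_map_eq_zero' := fun a ha => by
        rw [ENNReal.toReal_eq_zero_iff, or_iff_left (wnorm_ne_top a), wnorm,
          ENNReal.tsum_eq_zero] at ha
        apply coeffs_injective
        funext α
        have := ha α
        rw [enorm_eq_zero, mul_eq_zero] at this
        simpa using this.resolve_right (weight_pos (fun i => (ω i).2) α).ne' }

theorem norm_eq (a : WeightedSeries ω) : ‖a‖ = (wnorm (fun i => ω i) (coeffs a)).toReal := rfl

theorem norm_le_of_wnorm_le {a : WeightedSeries ω} {B : ℝ} (hB : 0 ≤ B)
    (h : wnorm (fun i => ω i) (coeffs a) ≤ ENNReal.ofReal B) : ‖a‖ ≤ B :=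
  ENNReal.toReal_le_of_le_ofReal hB h

theorem ofReal_norm (a : WeightedSeries ω) :
    ENNReal.ofReal ‖a‖ = wnorm (fun i => ω i) (coeffs a) := ENNReal.ofReal_toReal (wnorm_ne_top a)

instance : NormedCommRing (WeightedSeries ω) :=
  { (inferInstance : NormedAddCommGroup (WeightedSeries ω)),
    (inferInstance : CommRing (WeightedSeries ω)) with
    norm_mul_le := fun a b => by
      rw [norm_eq, norm_eq, norm_eq, ← ENNReal.toReal_mul]
      exact ENNReal.toReal_mono (ENNReal.mul_ne_top (wnorm_ne_top a) (wnorm_ne_top b))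
        (wnorm_mul_le (fun i => (ω i).2) a.1 b.1) }

instance : NormedAlgebra ℝ (WeightedSeries ω) :=
  { (inferInstance : Algebra ℝ (WeightedSeries ω)) with
    norm_smul_le := fun r a => by
      rw [norm_eq, coeffs_smul, wnorm_smul, ENNReal.toReal_mul, norm_eq]
      simp }

instance : NormOneClass (WeightedSeries ω) where
  norm_one := by rw [norm_eq, coeffs_one, wnorm_single]; simp [weight_zero]

instance : CompleteSpace (WeightedSeries ω) := by
  -- multiplication of the coefficients by the weights is an isometry onto `ℓ¹`
  have hw := weight_pos fun i => (ω i).2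
  let e : WeightedSeries ω ≃ lp (fun _ : ℕ →₀ ℕ => ℝ) 1 :=
    { toFun := fun a => ⟨fun α => (coeffs a) α * weight (fun i => ω i) α, memℓp_gen (by
        simpa using tsum_enorm_ne_top_iff_summable_norm.1 (wnorm_ne_top a))⟩
      invFun := fun x => mk (fun α => x α / weight (fun i => ω i) α) (by
        have := (lp.memℓp x).summable (by simp)
        refine tsum_enorm_ne_top_iff_summable_norm.2 ?_
        simp_rw [div_mul_cancel₀ _ (hw _).ne']
        simpa using this)
      left_inv := fun a => coeffs_injective (by
        funext α; exact mul_div_cancel_right₀ _ (hw α).ne')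
      right_inv := fun x => by
        ext α; exact div_mul_cancel₀ _ (hw α).ne' }
  have he : Isometry e := by
    refine Isometry.of_dist_eq fun a b => ?_
    rw [dist_eq_norm, dist_eq_norm, lp.norm_eq_tsum_rpow (by simp), norm_eq, wnorm]
    rw [ENNReal.tsum_toReal_eq fun _ => enorm_ne_top]
    simp only [ENNReal.toReal_one, Real.rpow_one, div_one, toReal_enorm]
    refine tsum_congr fun α => ?_
    rw [sub_eq_add_neg a b, coeffs_add, coeffs_neg]
    have h1 : (e a - e b) α = coeffs a α * weight (fun i => ω i) α
        - coeffs b α * weight (fun i => ω i) α := rfl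
    rw [h1, Pi.add_apply, Pi.neg_apply, ← sub_eq_add_neg, sub_mul]
  exact (IsometryEquiv.mk e he).completeSpace

/-- Evaluation at an admissible point is a homomorphism of algebras. -/
def eval (z : ℕ → ℝ) (hz : Admissible (fun i => ω i) z) : WeightedSeries ω →ₐ[ℝ] ℝ := by
  have hs : ∀ a : WeightedSeries ω, Summable fun α => ‖(coeffs a) α * monomial z α‖ := fun a =>
    (summable_iff_majorant.2 (ne_top_of_le_ne_top (wnorm_ne_top a)
      (majorant_le_wnorm (fun i => (ω i).2) hz _))).norm
  exact AlgHom.ofLinearMap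
    { toFun := fun a => ∑' α, (coeffs a) α * monomial z α
      map_add' := fun a b => by
        rw [← (hs a).of_norm.tsum_add (hs b).of_norm]
        exact tsum_congr fun α => by simp [add_mul]
      map_smul' := fun r a => by
        rw [RingHom.id_apply, smul_eq_mul, ← tsum_mul_left]
        exact tsum_congr fun α => by simp [mul_assoc] }
    (by
      show ∑' α, coeffs 1 α * monomial z α = 1
      rw [tsum_eq_single 0]
      · simp [coeffs_one, monomial_zero]
      · intro α hα; simp [coeffs_one, hα])
    (fun a b => by
      show ∑' α, coeffs (a * b) α * monomial z α
        = (∑' α, coeffs a α * monomial z α) * ∑' α, coeffs b α * monomial z α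
      rw [tsum_mul_tsum_monomial (hs a) (hs b)]
      exact tsum_congr fun γ => by rw [coeffs_mul])

theorem majorant_le_norm {z : ℕ → ℝ} (hz : Admissible (fun i => ω i) z) (a : WeightedSeries ω) :
    majorant (coeffs a) z ≤ ENNReal.ofReal ‖a‖ :=
  (majorant_le_wnorm (fun i => (ω i).2) hz _).trans_eq (ofReal_norm a).symm

theorem hasSum_eval {z : ℕ → ℝ} (hz : Admissible (fun i => ω i) z) (a : WeightedSeries ω) :
    HasSum (fun α => (coeffs a) α * monomial z α) (eval z hz a) :=
  (summable_iff_majorant.2 (ne_top_of_le_ne_top ENNReal.ofReal_ne_top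
    (majorant_le_norm hz a))).hasSum

theorem abs_eval_le {z : ℕ → ℝ} (hz : Admissible (fun i => ω i) z) (a : WeightedSeries ω) :
    |eval z hz a| ≤ ‖a‖ :=
  (abs_tsum_le_majorant (ne_top_of_le_ne_top ENNReal.ofReal_ne_top (majorant_le_norm hz a))).trans
    (ENNReal.toReal_le_of_le_ofReal (norm_nonneg _) (majorant_le_norm hz a))

theorem continuous_eval {z : ℕ → ℝ} (hz : Admissible (fun i => ω i) z) :
    Continuous (eval (ω := ω) z hz) :=
  AddMonoidHomClass.continuous_of_bound _ 1 fun a => by simpa using abs_eval_le hz a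

end WeightedSeries

/-! ### Substitution into an absolutely convergent power series -/

section Substitution

variable {ι B : Type*} [NormedCommRing B] [NormOneClass B]

/-- On half of a polydisc the monomials gain a factor `2 ^ (-|α|)`. -/
theorem norm_prod_pow_le {h : ι → B} {v : ι → ℝ} (hh : ∀ a, ‖h a‖ ≤ v a / 2) (α : ι →₀ ℕ) :
    ‖α.prod fun a k => h a ^ k‖ * 2 ^ α.degree ≤ monomial v α := by
  induction α using finsupp_induction_add_single with
  | h0 => simp [monomial_zero]
  | h1 α i ih =>
    have h0 : 0 ≤ monomial v α := le_trans (by positivity) ih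
    rw [prod_pow_add_single, monomial_add_single, map_add, degree_single, pow_succ]
    calc _ ≤ (‖α.prod fun a k => h a ^ k‖ * ‖h i‖) * (2 ^ α.degree * 2) := by
          gcongr; exact norm_mul_le _ _
      _ = (‖α.prod fun a k => h a ^ k‖ * 2 ^ α.degree) * (2 * ‖h i‖) := by ring
      _ ≤ monomial v α * v i := by
          gcongr
          linarith [hh i]

theorem norm_prod_pow_sub_le_aux {h k : ι → B} {v : ι → ℝ} {L : ℝ} (hL : 0 ≤ L)
    (hh : ∀ a, ‖h a‖ ≤ v a / 2) (hk : ∀ a, ‖k a‖ ≤ v a / 2) (hhk : ∀ a, ‖h a - k a‖ ≤ L * v a)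
    (α : ι →₀ ℕ) :
    ‖(α.prod fun a n => h a ^ n) - α.prod fun a n => k a ^ n‖ * 2 ^ α.degree
      ≤ 2 * α.degree * (L * monomial v α) := by
  induction α using finsupp_induction_add_single with
  | h0 => simp
  | h1 α i ih =>
    have hv : 0 ≤ v i := by linarith [norm_nonneg (h i), hh i]
    have h1 := norm_prod_pow_le hk α
    rw [prod_pow_add_single, prod_pow_add_single, monomial_add_single, map_add, degree_single,
      pow_succ]
    set p := α.prod fun a n => h a ^ n
    set q := α.prod fun a n => k a ^ n
    have e : p * h i - q * k i = (p - q) * h i + q * (h i - k i) := by ring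
    have h2 : ‖p * h i - q * k i‖ ≤ ‖p - q‖ * (v i / 2) + ‖q‖ * (L * v i) := by
      rw [e]
      refine (norm_add_le _ _).trans (add_le_add ((norm_mul_le _ _).trans ?_)
        ((norm_mul_le _ _).trans ?_))
      · gcongr; exact hh i
      · gcongr; exact hhk i
    push_cast
    calc _ ≤ (‖p - q‖ * (v i / 2) + ‖q‖ * (L * v i)) * (2 ^ α.degree * 2) := by gcongr
      _ = (‖p - q‖ * 2 ^ α.degree) * v i + (‖q‖ * 2 ^ α.degree) * (2 * L * v i) := by ring
      _ ≤ (2 * α.degree * (L * monomial v α)) * v i + monomial v α * (2 * L * v i) := by gcongr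
      _ = _ := by ring

/-- Monomials are Lipschitz on half of the polydisc of polyradius `v`, with a constant that does
not depend on their degree: the factor `|α|` from differentiation is absorbed by `2 ^ (-|α|)`. -/
theorem norm_prod_pow_sub_le {h k : ι → B} {v : ι → ℝ} {L : ℝ} (hL : 0 ≤ L)
    (hh : ∀ a, ‖h a‖ ≤ v a / 2) (hk : ∀ a, ‖k a‖ ≤ v a / 2) (hhk : ∀ a, ‖h a - k a‖ ≤ L * v a)
    (α : ι →₀ ℕ) :
    ‖(α.prod fun a n => h a ^ n) - α.prod fun a n => k a ^ n‖ ≤ L * monomial v α := by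
  have hm : 0 ≤ monomial v α := le_trans (by positivity) (norm_prod_pow_le hh α)
  have h1 := norm_prod_pow_sub_le_aux hL hh hk hhk α
  have h2 : (2 * α.degree : ℝ) ≤ 2 ^ α.degree := by
    rcases Nat.eq_zero_or_pos α.degree with h0 | h0
    · simp [h0]
    · obtain ⟨n, hn⟩ := Nat.exists_eq_succ_of_ne_zero h0.ne'
      have : n < 2 ^ n := Nat.lt_two_pow_self
      rw [hn, pow_succ]
      have : (n : ℝ) + 1 ≤ 2 ^ n := by exact_mod_cast this
      push_cast; linarith
  have h3 : ‖(α.prod fun a n => h a ^ n) - α.prod fun a n => k a ^ n‖ * 2 ^ α.degree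
      ≤ (L * monomial v α) * 2 ^ α.degree :=
    h1.trans (by rw [mul_comm (L * _)]; gcongr)
  exact le_of_mul_le_mul_right h3 (by positivity)

variable [NormedAlgebra ℝ B]

theorem norm_smul_prod_pow_le (c : (ι →₀ ℕ) → ℝ) {h : ι → B} {v : ι → ℝ}
    (hh : ∀ a, ‖h a‖ ≤ v a / 2) (α : ι →₀ ℕ) :
    ‖c α • α.prod fun a n => h a ^ n‖ ≤ |c α * monomial v α| := by
  have h1 := norm_prod_pow_le hh α
  have h2 : ‖α.prod fun a n => h a ^ n‖ ≤ monomial v α := by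
    refine le_trans ?_ h1
    exact le_mul_of_one_le_right (norm_nonneg _) (one_le_pow₀ (by norm_num))
  rw [norm_smul, abs_mul, Real.norm_eq_abs]
  gcongr
  exact h2.trans (le_abs_self _)

variable [CompleteSpace B]

theorem summable_smul_prod_pow {c : (ι →₀ ℕ) → ℝ} {h : ι → B} {v : ι → ℝ}
    (hc : Summable fun α => |c α * monomial v α|) (hh : ∀ a, ‖h a‖ ≤ v a / 2) :
    Summable fun α => c α • α.prod fun a n => h a ^ n :=
  Summable.of_norm_bounded hc fun α => norm_smul_prod_pow_le c hh α

/-- An absolutely convergent power series is Lipschitz on half of its polydisc. -/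
theorem norm_tsum_sub_le {c : (ι →₀ ℕ) → ℝ} {h k : ι → B} {v : ι → ℝ} {L : ℝ} (hL : 0 ≤ L)
    (hc : Summable fun α => |c α * monomial v α|)
    (hh : ∀ a, ‖h a‖ ≤ v a / 2) (hk : ∀ a, ‖k a‖ ≤ v a / 2) (hhk : ∀ a, ‖h a - k a‖ ≤ L * v a) :
    ‖(∑' α, c α • α.prod fun a n => h a ^ n) - ∑' α, c α • α.prod fun a n => k a ^ n‖
      ≤ L * ∑' α, |c α * monomial v α| := by
  rw [← (summable_smul_prod_pow hc hh).tsum_sub (summable_smul_prod_pow hc hk)]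
  refine tsum_of_norm_bounded (hc.hasSum.mul_left L) fun α => ?_
  rw [← smul_sub, norm_smul, abs_mul, Real.norm_eq_abs, mul_left_comm]
  gcongr
  refine (norm_prod_pow_sub_le hL hh hk hhk α).trans ?_
  gcongr
  exact le_abs_self _

/-- The equation `W = ∑ c α (g + Λ W) ^ α` has a solution when the affine maps `g a + Λ a` are
small compared with the polyradius `v` of convergence: the right-hand side is a contraction of a
ball. -/
theorem exists_eq_tsum_prod_pow {c : (ι →₀ ℕ) → ℝ} {v : ι → ℝ} (hv : ∀ a, 0 < v a)
    (hc : Summable fun α => |c α * monomial v α|) (g : ι → B) (Λ : ι → B →+ B)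
    (hg : ∀ a, ‖g a‖ ≤ v a / 4)
    (hΛ : ∀ a W, ‖Λ a W‖ ≤ v a / (4 * ((∑' α, |c α * monomial v α|) + 1)) * ‖W‖) :
    ∃ W : B, (∀ a, ‖g a + Λ a W‖ ≤ v a / 2) ∧
      HasSum (fun α => c α • α.prod fun a n => (g a + Λ a W) ^ n) W := by
  set M := ∑' α, |c α * monomial v α| with hM
  have hM0 : 0 ≤ M := tsum_nonneg fun _ => abs_nonneg _
  let T : B → B := fun W => ∑' α, c α • α.prod fun a n => (g a + Λ a W) ^ n
  let s : Set B := Metric.closedBall 0 M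
  have hs : ∀ W ∈ s, ∀ a, ‖g a + Λ a W‖ ≤ v a / 2 := by
    intro W hW a
    rw [mem_closedBall_zero_iff] at hW
    have h1 : v a / (4 * (M + 1)) * ‖W‖ ≤ v a / 4 := by
      have := (hv a).le
      rw [div_mul_eq_mul_div, div_le_div_iff₀ (by positivity) (by norm_num)]
      have : v a * ‖W‖ ≤ v a * (M + 1) := by gcongr; linarith
      linarith
    linarith [norm_add_le (g a) (Λ a W), hg a, hΛ a W]
  have hT : Set.MapsTo T s s := by
    intro W hW
    rw [mem_closedBall_zero_iff]
    exact tsum_of_norm_bounded hc.hasSum fun α => norm_smul_prod_pow_le c (hs W hW) α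
  have hcontr : ContractingWith (1 / 4) (hT.restrict T s s) := by
    refine ⟨by rw [← NNReal.coe_lt_coe]; norm_num, LipschitzWith.of_dist_le_mul fun x y => ?_⟩
    rw [Subtype.dist_eq, Subtype.dist_eq, dist_eq_norm, dist_eq_norm]
    have h1 := norm_tsum_sub_le (L := ‖(x : B) - y‖ / (4 * (M + 1))) (by positivity) hc
      (hs x x.2) (hs y y.2) (fun a => by
        have := hΛ a (x - y)
        rw [add_sub_add_left_eq_sub, ← map_sub]
        refine this.trans (le_of_eq ?_)
        ring)
    refine h1.trans ?_
    rw [← hM, div_mul_eq_mul_div, div_le_iff₀ (by positivity)]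
    have : ‖(x : B) - y‖ * M ≤ ‖(x : B) - y‖ * (M + 1) := by gcongr; linarith
    simp only [one_div, NNReal.coe_inv, NNReal.coe_ofNat]
    linarith
  obtain ⟨W, hW, hfix, -⟩ := hcontr.exists_fixedPoint'
    Metric.isClosed_closedBall.isComplete hT (x := 0) (by simpa [s] using hM0) (edist_ne_top _ _)
  refine ⟨W, hs W hW, ?_⟩
  have := (summable_smul_prod_pow hc (hs W hW)).hasSum
  have e : T W = W := hfix
  rwa [show (∑' α, c α • α.prod fun a n => (g a + Λ a W) ^ n) = W from e] at this

end Substitution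

/-! ### Power series on balls of `ℓ^q` -/

section Ball

variable {q : ℝ≥0∞} [Fact (1 ≤ q)]

theorem mem_lpBall {r : ℝ} {z : ℕ → ℝ} :
    z ∈ lpBall q r ↔ ∃ y : lp (fun _ : ℕ => ℝ) q, ‖y‖ < r ∧ (y : ℕ → ℝ) = z := by
  simp only [lpBall, Set.mem_image, mem_ball_zero_iff]

theorem coe_mem_lpBall {r : ℝ} {y : lp (fun _ : ℕ => ℝ) q} (hy : ‖y‖ < r) :
    (y : ℕ → ℝ) ∈ lpBall q r := mem_lpBall.2 ⟨y, hy, rfl⟩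

theorem q_ne_zero : q ≠ 0 := (lt_of_lt_of_le zero_lt_one (Fact.out : 1 ≤ q)).ne'

/-- The space `ℓ^q` and its norm are solid. -/
theorem exists_lp_of_abs_le (y : lp (fun _ : ℕ => ℝ) q) {w : ℕ → ℝ} (h : ∀ i, |w i| ≤ |y i|) :
    ∃ x : lp (fun _ : ℕ => ℝ) q, (x : ℕ → ℝ) = w ∧ ‖x‖ ≤ ‖y‖ := by
  refine ⟨⟨w, (lp.memℓp y).mono' h⟩, rfl, ?_⟩
  exact lp.norm_mono q_ne_zero h

theorem lpBall_solid {r : ℝ} {z w : ℕ → ℝ} (hz : z ∈ lpBall q r) (h : ∀ i, |w i| ≤ |z i|) :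
    w ∈ lpBall q r := by
  obtain ⟨y, hy, rfl⟩ := mem_lpBall.1 hz
  obtain ⟨x, rfl, hx⟩ := exists_lp_of_abs_le y h
  exact coe_mem_lpBall (hx.trans_lt hy)

theorem lpBall_mono {r s : ℝ} (h : r ≤ s) : lpBall q r ⊆ lpBall q s := by
  intro z hz
  obtain ⟨y, hy, rfl⟩ := mem_lpBall.1 hz
  exact coe_mem_lpBall (hy.trans_le h)

theorem zero_mem_lpBall {r : ℝ} (hr : 0 < r) : (0 : ℕ → ℝ) ∈ lpBall q r :=
  mem_lpBall.2 ⟨0, by simpa using hr, lp.coeFn_zero _ _⟩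

theorem smul_mem_lpBall {r l : ℝ} (hl : 0 < l) {z : ℕ → ℝ} (hz : z ∈ lpBall q (l * r)) :
    l⁻¹ • z ∈ lpBall q r := by
  obtain ⟨y, hy, rfl⟩ := mem_lpBall.1 hz
  refine mem_lpBall.2 ⟨l⁻¹ • y, ?_, by simp⟩
  rw [norm_smul, norm_inv, Real.norm_of_nonneg hl.le, inv_mul_lt_iff₀ hl]
  exact hy

theorem abs_lt_of_mem_lpBall {r : ℝ} {z : ℕ → ℝ} (hz : z ∈ lpBall q r) (i : ℕ) : |z i| < r := by
  obtain ⟨y, hy, rfl⟩ := mem_lpBall.1 hz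
  exact (lp.norm_apply_le_norm q_ne_zero y i).trans_lt hy

/-- Finitely many coordinates of a point of `ℓ^q` may be enlarged at a bounded cost. -/
theorem exists_lp_add_count (y : lp (fun _ : ℕ => ℝ) q) {η : ℝ} (hη : 0 ≤ η) (L : List ℕ) :
    ∃ x : lp (fun _ : ℕ => ℝ) q, (∀ j, |y j| + η * L.count j ≤ |x j|) ∧
      ‖x‖ ≤ ‖y‖ + η * L.length := by
  suffices h : ∃ x : lp (fun _ : ℕ => ℝ) q, (∀ j, x j = |y j| + η * L.count j) ∧
      ‖x‖ ≤ ‖y‖ + η * L.length by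
    obtain ⟨x, h1, h2⟩ := h
    exact ⟨x, fun j => (h1 j).symm.le.trans (le_abs_self _), h2⟩
  induction L with
  | nil =>
    obtain ⟨x, h1, h2⟩ := exists_lp_of_abs_le y (w := fun i => |y i|) (by simp)
    exact ⟨x, fun j => by simp [h1], by simpa using h2⟩
  | cons i L ih =>
    obtain ⟨x, h1, h2⟩ := ih
    refine ⟨x + lp.single q i η, fun j => ?_, ?_⟩
    · rw [lp.coeFn_add, Pi.add_apply, h1, List.count_cons, lp.single_apply]
      by_cases hj : j = i
      · subst hj; simp; ring
      · simp [Ne.symm hj, hj]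
    · refine (norm_add_le _ _).trans ?_
      rw [lp.norm_single (pos_iff_ne_zero.2 q_ne_zero), Real.norm_of_nonneg hη]
      push_cast [List.length_cons]; linarith

theorem coordOpen_lpBall (r : ℝ) : CoordOpen (lpBall q r) := by
  intro z hz i
  obtain ⟨y, hy, rfl⟩ := mem_lpBall.1 hz
  refine ⟨(r - ‖y‖) / 2, by linarith, fun s hs => ?_⟩
  obtain ⟨x, h1, h2⟩ := exists_lp_add_count y (η := (r - ‖y‖) / 2) (by linarith) [i]
  have hx : ‖x‖ < r := by simp at h2; linarith
  refine lpBall_solid (coe_mem_lpBall hx) fun j => ?_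
  have := h1 j
  by_cases hj : j = i
  · subst hj; simp at this ⊢; linarith
  · simp [hj, Ne.symm hj] at this ⊢; exact this

/-- There are points of the ball all of whose coordinates are positive. -/
theorem exists_pos_mem_lpBall {r : ℝ} (hr : 0 < r) : ∃ v ∈ lpBall q r, ∀ i, 0 < v i := by
  have h1 : Memℓp (fun i : ℕ => (1 / 2 : ℝ) ^ i) 1 := memℓp_gen (by
    simpa using summable_geometric_two)
  let y : lp (fun _ : ℕ => ℝ) q := ⟨_, h1.of_exponent_ge Fact.out⟩
  refine ⟨((r / 2 / (‖y‖ + 1)) • y : lp (fun _ : ℕ => ℝ) q), coe_mem_lpBall ?_, fun i => ?_⟩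
  · rw [norm_smul, Real.norm_of_nonneg (by positivity), div_mul_eq_mul_div,
      div_lt_iff₀ (by positivity)]
    nlinarith [norm_nonneg y]
  · have : (y : ℕ → ℝ) i = (1 / 2) ^ i := rfl
    rw [lp.coeFn_smul, Pi.smul_apply, this, smul_eq_mul]
    positivity

theorem continuous_lp_apply (i : ℕ) : Continuous fun y : lp (fun _ : ℕ => ℝ) q => y i :=
  (lp.lipschitzWith_one_eval q i).continuous

/-- A majorant which is finite on a ball of `ℓ^q` is bounded on a smaller one: by Baire's theorem
it is bounded near some point, and as it increases with the absolute values of the coordinates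
it is also bounded near `0`. -/
theorem exists_majorant_le {c : (ℕ →₀ ℕ) → ℝ} {r : ℝ} (hr : 0 < r)
    (h : ∀ z ∈ lpBall q r, majorant c z ≠ ⊤) :
    ∃ ε > 0, ∃ M : ℕ, ∀ z ∈ lpBall q ε, majorant c z ≤ M := by
  -- the sets covering the space: the complement of the ball, and the sublevel sets
  let F : Option ℕ → Set (lp (fun _ : ℕ => ℝ) q) := fun o =>
    o.elim {y | r ≤ ‖y‖} fun n => {y | majorant c y ≤ n}
  have hcl : ∀ o, IsClosed (F o) := by
    rintro (_ | n)
    · exact isClosed_le continuous_const continuous_norm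
    · have hlsc : LowerSemicontinuous fun y : lp (fun _ : ℕ => ℝ) q => majorant c y := by
        refine lowerSemicontinuous_tsum fun α => Continuous.lowerSemicontinuous ?_
        refine continuous_enorm.comp (continuous_const.mul ?_)
        exact continuous_finsetProd _ fun i _ => (continuous_lp_apply i).pow _
      exact hlsc.isClosed_preimage n
  have hU : ⋃ o, F o = Set.univ := by
    refine Set.eq_univ_of_forall fun y => Set.mem_iUnion.2 ?_
    by_cases hy : r ≤ ‖y‖
    · exact ⟨none, hy⟩
    · obtain ⟨n, hn⟩ := ENNReal.exists_nat_gt (h y (coe_mem_lpBall (not_le.1 hy)))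
      exact ⟨some n, hn.le⟩
  obtain ⟨y, hy, hyr⟩ := (dense_iUnion_interior_of_closed hcl hU).exists_mem_open
    Metric.isOpen_ball ⟨0, Metric.mem_ball_self (x := (0 : lp (fun _ : ℕ => ℝ) q)) hr⟩
  obtain ⟨o, ho⟩ := Set.mem_iUnion.1 hy
  rcases o with _ | n
  · have := interior_subset ho
    rw [mem_ball_zero_iff] at hyr
    exact absurd this (not_le.2 hyr)
  · obtain ⟨ε, hε, hball⟩ := Metric.isOpen_iff.1 isOpen_interior y ho
    refine ⟨ε, hε, n, fun z hz => ?_⟩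
    obtain ⟨x, hx, rfl⟩ := mem_lpBall.1 hz
    -- the signs are chosen so that the coordinates of `y + x'` are as large as possible
    obtain ⟨x', h1, h2⟩ := exists_lp_of_abs_le x
      (w := fun i => if 0 ≤ y i then |x i| else -|x i|) (fun i => by split_ifs <;> simp)
    have h3 : y + x' ∈ F (some n) := interior_subset (hball (by
      rw [mem_ball_iff_norm, add_sub_cancel_left]; exact h2.trans_lt hx))
    refine le_trans (majorant_mono fun i => ?_) h3
    rw [lp.coeFn_add, Pi.add_apply, h1]
    dsimp only
    split_ifs with h0
    · rw [abs_of_nonneg (add_nonneg h0 (abs_nonneg _))]; linarith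
    · rw [abs_of_nonpos (add_nonpos (not_le.1 h0).le (neg_nonpos.2 (abs_nonneg _)))]
      linarith [not_le.1 h0]

/-- Hölder's inequality: a small ball of `ℓ^q` consists of points at which the series of the
weighted algebra converge. -/
theorem exists_lpBall_admissible {p : ℝ} (hp : 1 ≤ p)
    (hpq : (ENNReal.ofReal p).HolderConjugate q) {ω : ℕ → ℝ} (hω : ∀ i, 0 < ω i)
    (hs : Summable fun i => 1 / |ω i| ^ p) :
    ∃ r > 0, ∀ z ∈ lpBall q r, Admissible ω z := by
  have hmem : Memℓp (fun i => (ω i)⁻¹) (ENNReal.ofReal p) := memℓp_gen (by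
    rw [ENNReal.toReal_ofReal (by linarith)]
    refine hs.congr fun i => ?_
    rw [norm_inv, Real.norm_eq_abs, Real.inv_rpow (abs_nonneg _), one_div])
  suffices h : ∃ C : ℝ, 0 ≤ C ∧ ∀ (y : lp (fun _ : ℕ => ℝ) q) (s : Finset ℕ),
      ∑ i ∈ s, |y i| / ω i ≤ C * ‖y‖ by
    obtain ⟨C, hC, h⟩ := h
    refine ⟨1 / (C + 1), by positivity, fun z hz s => ?_⟩
    obtain ⟨y, hy, rfl⟩ := mem_lpBall.1 hz
    refine (h y s).trans ?_
    rw [lt_div_iff₀ (by positivity)] at hy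
    nlinarith [norm_nonneg y]
  rcases eq_or_ne q ⊤ with hq | hq
  · have h1 : p = 1 := by
      subst hq
      have h2 := ENNReal.HolderConjugate.inv_add_inv_eq_one (ENNReal.ofReal p) ⊤
      rw [ENNReal.inv_top, add_zero, ENNReal.inv_eq_one] at h2
      simpa using h2
    subst h1
    have hsum : Summable fun i => (ω i)⁻¹ := by
      refine hs.congr fun i => ?_
      rw [Real.rpow_one, abs_of_pos (hω i), one_div]
    refine ⟨∑' i, (ω i)⁻¹, tsum_nonneg fun i => (inv_pos.2 (hω i)).le, fun y s => ?_⟩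
    calc ∑ i ∈ s, |y i| / ω i ≤ ∑ i ∈ s, (ω i)⁻¹ * ‖y‖ := by
          refine Finset.sum_le_sum fun i _ => ?_
          rw [div_eq_inv_mul]
          have := (inv_pos.2 (hω i)).le
          gcongr
          exact lp.norm_apply_le_norm q_ne_zero y i
      _ = (∑ i ∈ s, (ω i)⁻¹) * ‖y‖ := by rw [Finset.sum_mul]
      _ ≤ _ := by
          gcongr
          exact hsum.sum_le_tsum _ fun i _ => (inv_pos.2 (hω i)).le
  · have hpq' : (ENNReal.ofReal p).toReal.HolderConjugate q.toReal :=
      ENNReal.HolderConjugate.toReal_of_ne_top ENNReal.ofReal_ne_top hq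
    let w : lp (fun _ : ℕ => ℝ) (ENNReal.ofReal p) := ⟨_, hmem⟩
    refine ⟨‖w‖, lp.norm_nonneg' _, fun y s => ?_⟩
    refine le_trans ?_ (lp.tsum_mul_le_mul_norm' hpq' w y)
    refine le_trans (le_of_eq ?_) ((lp.summable_mul hpq' w y).sum_le_tsum s fun i _ => by positivity)
    refine Finset.sum_congr rfl fun i _ => ?_
    have : (w : ℕ → ℝ) i = (ω i)⁻¹ := rfl
    rw [this, norm_inv, Real.norm_of_nonneg (hω i).le, Real.norm_eq_abs, div_eq_inv_mul]

end Ball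

/-! ### Continuous differentiability -/

section Regularity

/-- The linear part in `h` of `(z + h) ^ α`, with Cauchy-type estimates for it and for the
remainder which compare them with the single number `(|z| + S |h|) ^ α`. -/
theorem exists_linear_part (α : ℕ →₀ ℕ) : ∃ l : (ℕ → ℝ) → (ℕ → ℝ) →ₗ[ℝ] ℝ, ∀ z h : ℕ → ℝ,
    (∀ S : ℝ, 0 ≤ S → |l z h| * S ≤ monomial (fun i => |z i| + S * |h i|) α) ∧
    ∀ S : ℝ, 1 ≤ S → |monomial (z + h) α - monomial z α - l z h| * S ^ 2
      ≤ monomial (fun i => |z i| + S * |h i|) α := by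
  have hz : ∀ (α : ℕ →₀ ℕ) (z h : ℕ → ℝ) (S : ℝ), 0 ≤ S →
      |monomial z α| ≤ monomial (fun i => |z i| + S * |h i|) α := by
    intro α z h S hS
    have hn : ∀ i, 0 ≤ |z i| + S * |h i| := fun i => by positivity
    refine (abs_monomial_mono (z := fun i => |z i| + S * |h i|) (fun i => ?_) α).trans_eq
      (abs_of_nonneg (monomial_nonneg hn α))
    rw [abs_of_nonneg (hn i)]
    have : 0 ≤ S * |h i| := by positivity
    linarith
  have hzh : ∀ (α : ℕ →₀ ℕ) (z h : ℕ → ℝ) (S : ℝ), 1 ≤ S →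
      |monomial (z + h) α| ≤ monomial (fun i => |z i| + S * |h i|) α := by
    intro α z h S hS
    have hn : ∀ i, 0 ≤ |z i| + S * |h i| := fun i => by positivity
    refine (abs_monomial_mono (z := fun i => |z i| + S * |h i|) (fun i => ?_) α).trans_eq
      (abs_of_nonneg (monomial_nonneg hn α))
    rw [abs_of_nonneg (hn i), Pi.add_apply]
    have := mul_le_mul_of_nonneg_right hS (abs_nonneg (h i))
    linarith [abs_add_le (z i) (h i)]
  have hdiff : ∀ (α : ℕ →₀ ℕ) (z h : ℕ → ℝ) (S : ℝ), 1 ≤ S →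
      |monomial (z + h) α - monomial z α| * S ≤ monomial (fun i => |z i| + S * |h i|) α := by
    intro α z h S hS
    induction α using finsupp_induction_add_single with
    | h0 => simp [monomial_zero]
    | h1 α a ih =>
      rw [monomial_add_single, monomial_add_single, monomial_add_single]
      set m := monomial (fun i => |z i| + S * |h i|) α
      have e : monomial (z + h) α * (z + h) a - monomial z α * z a
          = z a * (monomial (z + h) α - monomial z α) + h a * monomial (z + h) α := by
        rw [Pi.add_apply]; ring
      rw [e]
      calc _ ≤ (|z a| * |monomial (z + h) α - monomial z α| + |h a| * |monomial (z + h) α|) * S := by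
            gcongr
            refine (abs_add_le _ _).trans_eq ?_
            rw [abs_mul, abs_mul]
        _ = |z a| * (|monomial (z + h) α - monomial z α| * S)
            + S * |h a| * |monomial (z + h) α| := by ring
        _ ≤ |z a| * m + S * |h a| * m := by gcongr; exact hzh α z h S hS
        _ = _ := by ring
  induction α using finsupp_induction_add_single with
  | h0 => exact ⟨0, fun z h => by simp [monomial_zero]⟩
  | h1 α a ih =>
    obtain ⟨l, hl⟩ := ih
    refine ⟨fun z => z a • l z + monomial z α • LinearMap.proj a, fun z h => ⟨fun S hS => ?_,
      fun S hS => ?_⟩⟩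
    · rw [monomial_add_single]
      have h1 := (hl z h).1 S hS
      have h2 := hz α z h S hS
      set m := monomial (fun i => |z i| + S * |h i|) α
      simp only [LinearMap.add_apply, LinearMap.smul_apply, smul_eq_mul, LinearMap.proj_apply]
      calc _ ≤ (|z a| * |l z h| + |monomial z α| * |h a|) * S := by
            gcongr
            refine (abs_add_le _ _).trans_eq ?_
            rw [abs_mul, abs_mul]
        _ = |z a| * (|l z h| * S) + |monomial z α| * (S * |h a|) := by ring
        _ ≤ |z a| * m + m * (S * |h a|) := by gcongr
        _ = _ := by ring
    · have h1 := (hl z h).2 S hS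
      have h2 := hdiff α z h S hS
      rw [monomial_add_single, monomial_add_single, monomial_add_single]
      set m := monomial (fun i => |z i| + S * |h i|) α
      simp only [LinearMap.add_apply, LinearMap.smul_apply, smul_eq_mul, LinearMap.proj_apply,
        Pi.add_apply]
      set d := monomial (z + h) α - monomial z α - l z h with hd
      have e : monomial (z + h) α * (z a + h a) - monomial z α * z a
          - (z a * l z h + monomial z α * h a)
          = z a * d + h a * (monomial (z + h) α - monomial z α) := by rw [hd]; ring
      rw [e]
      calc _ ≤ (|z a| * |d| + |h a| * |monomial (z + h) α - monomial z α|) * S ^ 2 := by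
            gcongr
            refine (abs_add_le _ _).trans_eq ?_
            rw [abs_mul, abs_mul]
        _ = |z a| * (|d| * S ^ 2) + S * |h a| * (|monomial (z + h) α - monomial z α| * S) := by ring
        _ ≤ |z a| * m + S * |h a| * m := by gcongr
        _ = _ := by ring

/-- A function with a uniform second order Taylor estimate is continuously differentiable. -/
theorem continuousOn_fderiv_of_taylor {E : Type*} [NormedAddCommGroup E] [NormedSpace ℝ E]
    {u : E → ℝ} {T : E → E →L[ℝ] ℝ} {C δ : ℝ} (hδ : 0 < δ) (hC : 0 ≤ C)
    (h : ∀ z, ‖z‖ < δ → ∀ k, ‖k‖ ≤ δ → |u (z + k) - u z - T z k| ≤ C * ‖k‖ ^ 2) :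
    (∀ z ∈ Metric.ball (0 : E) δ, DifferentiableAt ℝ u z) ∧
      ContinuousOn (fderiv ℝ u) (Metric.ball 0 δ) := by
  have hd : ∀ z ∈ Metric.ball (0 : E) δ, HasFDerivAt u (T z) z := by
    intro z hz
    rw [mem_ball_zero_iff] at hz
    have hO : (fun x => u x - u z - T z (x - z)) =O[𝓝 z] fun x => ‖x - z‖ ^ 2 := by
      refine Asymptotics.IsBigO.of_bound C ?_
      filter_upwards [Metric.ball_mem_nhds z hδ] with x hx
      rw [mem_ball_iff_norm] at hx
      have := h z hz (x - z) hx.le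
      rw [add_sub_cancel] at this
      simpa using this
    have h1 : (fun x => u x - u z - T z (x - z)) =o[𝓝 z] fun x => x - z :=
      hO.trans_isLittleO (Asymptotics.isLittleO_norm_pow_id one_lt_two |>.comp_tendsto (by
        have : Tendsto (fun x : E => x - z) (𝓝 z) (𝓝 (z - z)) :=
          (continuous_id.sub continuous_const).tendsto z
        rwa [sub_self] at this))
    exact HasFDerivAt.of_isLittleO h1
  refine ⟨fun z hz => (hd z hz).differentiableAt, ?_⟩
  refine ContinuousOn.congr (f := T) ?_ fun z hz => (hd z hz).fderiv
  have hlip : ∀ z, ‖z‖ < δ → ∀ k, ‖k‖ ≤ δ / 2 → ‖z + k‖ < δ →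
      ‖T (z + k) - T z‖ ≤ 6 * C * ‖k‖ := by
    intro z hz k hk hzk
    rcases eq_or_ne k 0 with rfl | hk0
    · simp
    have hk1 : 0 < ‖k‖ := norm_pos_iff.2 hk0
    refine ContinuousLinearMap.opNorm_le_of_unit_norm (by positivity) fun x hx => ?_
    have hn : ‖‖k‖ • x‖ = ‖k‖ := by rw [norm_smul, hx]; simp
    have h1 := h (z + k) hzk (‖k‖ • x) (by rw [hn]; linarith)
    have h2 := h z hz (k + ‖k‖ • x) ((norm_add_le _ _).trans (by rw [hn]; linarith))
    have h3 := h z hz k (by linarith)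
    have h4 : ‖k + ‖k‖ • x‖ ^ 2 ≤ 4 * ‖k‖ ^ 2 := by
      have : ‖k + ‖k‖ • x‖ ≤ 2 * ‖k‖ := (norm_add_le _ _).trans (by rw [hn]; linarith)
      nlinarith [norm_nonneg (k + ‖k‖ • x)]
    rw [hn] at h1
    rw [← add_assoc] at h2
    rw [map_smul, smul_eq_mul] at h1
    rw [map_add, map_smul, smul_eq_mul] at h2
    rw [_root_.sub_apply, Real.norm_eq_abs]
    have h5 : C * ‖k + ‖k‖ • x‖ ^ 2 ≤ C * (4 * ‖k‖ ^ 2) := by gcongr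
    have h6 : ‖k‖ * |T (z + k) x - T z x| ≤ ‖k‖ * (6 * C * ‖k‖) := by
      rw [← abs_of_pos hk1, ← abs_mul, abs_of_pos hk1]
      rw [abs_le] at h1 h2 h3 ⊢
      constructor <;> nlinarith
    exact le_of_mul_le_mul_left h6 hk1
  intro z hz
  rw [mem_ball_zero_iff] at hz
  refine ContinuousAt.continuousWithinAt ?_
  rw [ContinuousAt, tendsto_iff_norm_sub_tendsto_zero]
  have hlim : Tendsto (fun x : E => 6 * C * ‖x - z‖) (𝓝 z) (𝓝 0) := by
    have : Tendsto (fun x : E => 6 * C * ‖x - z‖) (𝓝 z) (𝓝 (6 * C * ‖z - z‖)) :=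
      Continuous.tendsto (by fun_prop) z
    simpa using this
  refine squeeze_zero' (Eventually.of_forall fun _ => norm_nonneg _) ?_ hlim
  filter_upwards [Metric.ball_mem_nhds z (half_pos hδ),
    Metric.isOpen_ball.mem_nhds (mem_ball_zero_iff.2 hz)] with x hx hx'
  rw [mem_ball_iff_norm] at hx
  rw [mem_ball_zero_iff] at hx'
  have := hlip z hz (x - z) hx.le (by rwa [add_sub_cancel])
  rwa [add_sub_cancel] at this

variable {q : ℝ≥0∞} [Fact (1 ≤ q)]

/-- The sum of a power series on a ball of `ℓ^q` is continuously differentiable near `0`. -/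
theorem exists_continuousOn_fderiv {r : ℝ} (hr : 0 < r) {c : (ℕ →₀ ℕ) → ℝ} {u : (ℕ → ℝ) → ℝ}
    (hu : Represents (lpBall q r) c u) :
    ∃ s : ℝ, 0 < s ∧ s ≤ r ∧
      (∀ y ∈ Metric.ball (0 : lp (fun _ : ℕ => ℝ) q) s,
        DifferentiableAt ℝ (fun y : lp (fun _ : ℕ => ℝ) q => u (y : ℕ → ℝ)) y) ∧
      ContinuousOn (fderiv ℝ (fun y : lp (fun _ : ℕ => ℝ) q => u (y : ℕ → ℝ)))
        (Metric.ball 0 s) := by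
  obtain ⟨ε₀, hε₀, M, hM₀⟩ := exists_majorant_le hr fun z hz => hu.majorant_ne_top hz
  obtain ⟨ε, hε, hεr, hM⟩ : ∃ ε > 0, ε ≤ r ∧ ∀ z ∈ lpBall q ε, majorant c z ≤ M :=
    ⟨min ε₀ r, lt_min hε₀ hr, min_le_right _ _, fun z hz => hM₀ z (lpBall_mono (min_le_left _ _) hz)⟩
  choose l hl using exists_linear_part
  -- for `‖z‖ < ε / 2` and `S = ε / (2 ‖h‖)` the point `|z| + S |h|` lies in the ball of radius `ε`
  have hpt : ∀ z h : lp (fun _ : ℕ => ℝ) q, ‖z‖ < ε / 2 → h ≠ 0 →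
      (Summable fun α => |c α * monomial (fun i => |z i| + ε / 2 / ‖h‖ * |h i|) α|) ∧
      ∑' α, |c α * monomial (fun i => |z i| + ε / 2 / ‖h‖ * |h i|) α| ≤ M := by
    intro z h hz hh
    obtain ⟨z', h1, h2⟩ := exists_lp_of_abs_le z (w := fun i => |z i|) (by simp)
    obtain ⟨h', h3, h4⟩ := exists_lp_of_abs_le h (w := fun i => |h i|) (by simp)
    have hh0 : 0 < ‖h‖ := norm_pos_iff.2 hh
    have hmem : (fun i => |z i| + ε / 2 / ‖h‖ * |h i|) ∈ lpBall q ε := by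
      refine mem_lpBall.2 ⟨z' + (ε / 2 / ‖h‖) • h', ?_, ?_⟩
      · refine (norm_add_le _ _).trans_lt ?_
        rw [norm_smul, Real.norm_of_nonneg (by positivity)]
        have : ε / 2 / ‖h‖ * ‖h'‖ ≤ ε / 2 := by
          rw [div_mul_eq_mul_div, div_le_iff₀ hh0]; gcongr
        linarith
      · rw [lp.coeFn_add, lp.coeFn_smul, h1, h3]; rfl
    have h5 := hM _ hmem
    have h6 := ne_top_of_le_ne_top (ENNReal.natCast_ne_top M) h5
    refine ⟨(summable_iff_majorant.2 h6).abs, ?_⟩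
    rw [majorant] at h5 h6
    have := ENNReal.toReal_mono (ENNReal.natCast_ne_top M) h5
    rw [ENNReal.tsum_toReal_eq fun _ => enorm_ne_top] at this
    simpa using this
  have hT : ∀ z h : lp (fun _ : ℕ => ℝ) q, ‖z‖ < ε / 2 →
      (Summable fun α => c α * l α z h) ∧ |∑' α, c α * l α z h| ≤ 2 * M / ε * ‖h‖ := by
    intro z h hz
    rcases eq_or_ne h 0 with rfl | hh
    · have h0 : ∀ α, c α * l α z ((0 : lp (fun _ : ℕ => ℝ) q) : ℕ → ℝ) = 0 := fun α => by
        rw [lp.coeFn_zero]; exact (congrArg _ (map_zero (l α z))).trans (mul_zero _)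
      simp only [h0]
      simp [summable_zero]
    have hh0 : 0 < ‖h‖ := norm_pos_iff.2 hh
    obtain ⟨h1, h2⟩ := hpt z h hz hh
    have hb : ∀ α, ‖c α * l α z h‖ ≤
        ‖h‖ / (ε / 2) * |c α * monomial (fun i => |z i| + ε / 2 / ‖h‖ * |h i|) α| := by
      intro α
      have h3 := (hl α z h).1 (ε / 2 / ‖h‖) (by positivity)
      rw [norm_mul, abs_mul, Real.norm_eq_abs, Real.norm_eq_abs, mul_left_comm]
      gcongr
      rw [div_mul_eq_mul_div, le_div_iff₀ (by positivity)]
      rw [← mul_div_assoc, div_le_iff₀ hh0] at h3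
      refine h3.trans ?_
      rw [mul_comm]; gcongr; exact le_abs_self _
    refine ⟨Summable.of_norm_bounded (h1.mul_left _) hb, ?_⟩
    refine (tsum_of_norm_bounded (h1.hasSum.mul_left _) hb).trans ?_
    calc _ ≤ ‖h‖ / (ε / 2) * M := by gcongr
      _ = _ := by field_simp
  let T : lp (fun _ : ℕ => ℝ) q → lp (fun _ : ℕ => ℝ) q →L[ℝ] ℝ := fun z =>
    if hz : ‖z‖ < ε / 2 then
      LinearMap.mkContinuous
        { toFun := fun h => ∑' α, c α * l α z h
          map_add' := fun h k => by
            rw [← (hT z h hz).1.tsum_add (hT z k hz).1]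
            exact tsum_congr fun α => by rw [lp.coeFn_add, map_add, mul_add]
          map_smul' := fun a h => by
            rw [RingHom.id_apply, smul_eq_mul, ← tsum_mul_left]
            exact tsum_congr fun α => by rw [lp.coeFn_smul, map_smul, smul_eq_mul]; ring }
        (2 * M / ε) fun h => (hT z h hz).2
    else 0
  have hTaylor : ∀ z : lp (fun _ : ℕ => ℝ) q, ‖z‖ < ε / 2 → ∀ h : lp (fun _ : ℕ => ℝ) q,
      ‖h‖ ≤ ε / 2 → |u (z + h : lp (fun _ : ℕ => ℝ) q) - u z - T z h| ≤ 4 * M / ε ^ 2 * ‖h‖ ^ 2 := by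
    intro z hz h hhε
    have hTz : T z h = ∑' α, c α * l α z h := by simp only [T, dif_pos hz]; rfl
    rcases eq_or_ne h 0 with rfl | hh
    · simp
    have hh0 : 0 < ‖h‖ := norm_pos_iff.2 hh
    obtain ⟨h1, h2⟩ := hpt z h hz hh
    have hs1 := hu _ (coe_mem_lpBall (y := z + h)
      (((norm_add_le _ _).trans_lt (by linarith : ‖z‖ + ‖h‖ < ε)).trans_le hεr))
    have hs2 := hu _ (coe_mem_lpBall (y := z) (by linarith))
    have hs3 := ((hs1.sub hs2).sub (hT z h hz).1.hasSum)
    rw [hTz, ← hs3.tsum_eq, ← Real.norm_eq_abs]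
    have hS : 1 ≤ ε / 2 / ‖h‖ := by rwa [le_div_iff₀ hh0, one_mul]
    refine (tsum_of_norm_bounded (h1.hasSum.mul_left ((‖h‖ / (ε / 2)) ^ 2)) fun α => ?_).trans ?_
    · have h3 := (hl α z h).2 _ hS
      rw [← mul_sub, ← mul_sub, norm_mul, abs_mul, Real.norm_eq_abs, Real.norm_eq_abs,
        mul_left_comm, lp.coeFn_add]
      gcongr
      rw [div_pow, div_mul_eq_mul_div, le_div_iff₀ (by positivity)]
      rw [div_pow, ← mul_div_assoc, div_le_iff₀ (by positivity)] at h3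
      refine h3.trans ?_
      rw [mul_comm]; gcongr; exact le_abs_self _
    · calc _ ≤ (‖h‖ / (ε / 2)) ^ 2 * M := by gcongr
        _ = _ := by field_simp; ring
  obtain ⟨h1, h2⟩ := continuousOn_fderiv_of_taylor
    (u := fun y : lp (fun _ : ℕ => ℝ) q => u (y : ℕ → ℝ)) (C := 4 * M / ε ^ 2)
    (half_pos hε) (by positivity) hTaylor
  exact ⟨ε / 2, half_pos hε, by linarith, h1, h2⟩

end Regularity

/-! ### Primitives in time and initial data -/

section Time

/-- The multi-index in the variables `(t, x)` that does not involve `t` and is `α` in `x`. -/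
def spaceIndex (α : ℕ →₀ ℕ) : ℕ →₀ ℕ := α.mapDomain Nat.succ

@[simp] theorem spaceIndex_zero_apply (α : ℕ →₀ ℕ) : spaceIndex α 0 = 0 :=
  Finsupp.mapDomain_of_notMem_range _ _ (by simp)

@[simp] theorem spaceIndex_succ_apply (α : ℕ →₀ ℕ) (i : ℕ) : spaceIndex α (i + 1) = α i :=
  Finsupp.mapDomain_apply Nat.succ_injective _ _

theorem spaceIndex_add_single (α : ℕ →₀ ℕ) (i : ℕ) :
    spaceIndex (α + single i 1) = spaceIndex α + single (i + 1) 1 := by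
  simp [spaceIndex, Finsupp.mapDomain_add]

theorem spaceIndex_injective : Function.Injective spaceIndex :=
  Finsupp.mapDomain_injective Nat.succ_injective

@[simp] theorem spaceIndex_zero : spaceIndex 0 = 0 := Finsupp.mapDomain_zero

theorem monomial_spaceIndex (z : ℕ → ℝ) (α : ℕ →₀ ℕ) :
    monomial z (spaceIndex α) = monomial (fun i => z (i + 1)) α :=
  Finsupp.prod_mapDomain_index_inj Nat.succ_injective

/-- The part of a multi-index in the variables `(t, x)` that concerns `x`. -/
def tail (α : ℕ →₀ ℕ) : ℕ →₀ ℕ := α.comapDomain Nat.succ Nat.succ_injective.injOn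

@[simp] theorem tail_apply (α : ℕ →₀ ℕ) (i : ℕ) : tail α i = α (i + 1) := rfl

@[simp] theorem tail_spaceIndex (α : ℕ →₀ ℕ) : tail (spaceIndex α) = α := by ext i; simp

theorem spaceIndex_tail {α : ℕ →₀ ℕ} (h : α 0 = 0) : spaceIndex (tail α) = α := by
  ext i
  cases i with
  | zero => simp [h]
  | succ i => simp

/-- The coefficients of the restriction of a series to `t = 0`. -/
def restrict (c : (ℕ →₀ ℕ) → ℝ) : (ℕ →₀ ℕ) → ℝ := fun α => c (spaceIndex α)

/-- The coefficients of a series in `x`, regarded as a series in `(t, x)`. -/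
def extend (c : (ℕ →₀ ℕ) → ℝ) : (ℕ →₀ ℕ) → ℝ := fun α => if α 0 = 0 then c (tail α) else 0

/-- The formal primitive in `t` that vanishes for `t = 0`. -/
def J (c : (ℕ →₀ ℕ) → ℝ) : (ℕ →₀ ℕ) → ℝ :=
  fun α => if α 0 = 0 then 0 else c (α - single 0 1) / α 0

theorem restrict_extend (c : (ℕ →₀ ℕ) → ℝ) : restrict (extend c) = c := by
  funext α; simp [restrict, extend]

theorem restrict_J (c : (ℕ →₀ ℕ) → ℝ) : restrict (J c) = 0 := by
  funext α; simp [restrict, J]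

theorem restrict_add (c d : (ℕ →₀ ℕ) → ℝ) : restrict (c + d) = restrict c + restrict d := rfl

theorem D_zero_extend (c : (ℕ →₀ ℕ) → ℝ) : D 0 (extend c) = 0 := by
  funext α; simp [D, extend]

theorem D_zero_J (c : (ℕ →₀ ℕ) → ℝ) : D 0 (J c) = c := by
  funext α
  simp only [D, J, Finsupp.add_apply, single_eq_same, add_tsub_cancel_right]
  rw [if_neg (by omega)]
  push_cast
  field_simp

theorem D_of_zero (i : ℕ) : D i 0 = 0 := by funext α; simp [D]

theorem J_add (c d : (ℕ →₀ ℕ) → ℝ) : J (c + d) = J c + J d := by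
  funext α
  simp only [J, Pi.add_apply]
  split_ifs <;> simp [add_div]

theorem J_iterate_add (n : ℕ) (c d : (ℕ →₀ ℕ) → ℝ) : J^[n] (c + d) = J^[n] c + J^[n] d := by
  induction n with
  | zero => rfl
  | succ n ih => simp only [Function.iterate_succ_apply', ih, J_add]

theorem D_iterate_add (i n : ℕ) (c d : (ℕ →₀ ℕ) → ℝ) :
    (D i)^[n] (c + d) = (D i)^[n] c + (D i)^[n] d := by
  rw [← DL_replicate, ← DL_replicate, ← DL_replicate, DL_add]

theorem D_iterate_of_zero (i n : ℕ) : (D i)^[n] 0 = 0 :=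
  Function.iterate_fixed (D_of_zero i) n

theorem D_zero_iterate_J (n k : ℕ) (c : (ℕ →₀ ℕ) → ℝ) :
    (D 0)^[n] (J^[n + k] c) = J^[k] c := by
  induction n with
  | zero => simp
  | succ n ih =>
    rw [Function.iterate_succ_apply, add_right_comm, Function.iterate_succ_apply' J, D_zero_J, ih]

theorem J_D {i : ℕ} (hi : i ≠ 0) (c : (ℕ →₀ ℕ) → ℝ) : D i (J c) = J (D i c) := by
  funext α
  have h0 : (α + single i 1 : ℕ →₀ ℕ) 0 = α 0 := by simp [hi.symm]
  simp only [D, J, h0]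
  split_ifs with h
  · simp
  · have e : α + single i 1 - single 0 1 = α - single 0 1 + single i 1 :=
      tsub_add_eq_add_tsub (by simpa [Finsupp.single_le_iff, Nat.one_le_iff_ne_zero] using h) |>.symm
    have e2 : (α - single 0 1 : ℕ →₀ ℕ) i = α i := by simp [hi]
    rw [e, e2]; ring

theorem DL_J_iterate {L : List ℕ} (hL : ∀ i ∈ L, i ≠ 0) (n : ℕ) (c : (ℕ →₀ ℕ) → ℝ) :
    DL L (J^[n] c) = J^[n] (DL L c) := by
  induction n generalizing c with
  | zero => rfl
  | succ n ih =>
    rw [Function.iterate_succ_apply, ih, Function.iterate_succ_apply]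
    congr 1
    clear ih
    induction L with
    | nil => rfl
    | cons i L ihL =>
      rw [DL_cons, DL_cons, ihL fun j hj => hL j (List.mem_cons_of_mem _ hj),
        J_D (hL i List.mem_cons_self)]

theorem restrict_D_succ (i : ℕ) (c : (ℕ →₀ ℕ) → ℝ) :
    restrict (D (i + 1) c) = D i (restrict c) := by
  funext α; simp [restrict, D, spaceIndex_add_single]

theorem restrict_DL (L : List ℕ) (c : (ℕ →₀ ℕ) → ℝ) :
    restrict (DL (L.map Nat.succ) c) = DL L (restrict c) := by
  induction L with
  | nil => rfl
  | cons i L ih => rw [List.map_cons, DL_cons, restrict_D_succ, ih, DL_cons]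

theorem hasSum_restrict {c : (ℕ →₀ ℕ) → ℝ} {z : ℕ → ℝ} (hz : z 0 = 0) {a : ℝ}
    (h : HasSum (fun α => c α * monomial z α) a) :
    HasSum (fun α => restrict c α * monomial (fun i => z (i + 1)) α) a := by
  rw [← spaceIndex_injective.hasSum_iff] at h
  · refine h.congr_fun fun α => ?_
    simp [restrict, monomial_spaceIndex]
  · intro α hα
    have h0 : α 0 ≠ 0 := fun h0 => hα ⟨tail α, spaceIndex_tail h0⟩
    rw [monomial_eq_erase z α 0, hz, zero_pow h0]; simp

theorem majorant_extend_le (c : (ℕ →₀ ℕ) → ℝ) (z : ℕ → ℝ) :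
    majorant (extend c) z ≤ majorant c fun i => z (i + 1) := by
  rw [majorant, ← spaceIndex_injective.tsum_eq]
  · refine ENNReal.tsum_le_tsum fun α => ?_
    simp [extend, monomial_spaceIndex]
  · intro α hα
    have h0 : α 0 = 0 := by
      by_contra h0; simp [extend, h0] at hα
    exact ⟨tail α, spaceIndex_tail h0⟩

/-- A sum over the multi-indices that contain `i` may be shifted. -/
theorem tsum_eq_tsum_add_single {f : (ℕ →₀ ℕ) → ℝ≥0∞} {i : ℕ} (hf : ∀ α, α i = 0 → f α = 0) :
    ∑' α, f α = ∑' α, f (α + single i 1) := by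
  refine ((add_left_injective (single i 1 : ℕ →₀ ℕ)).tsum_eq fun α hα => ?_).symm
  have h0 : α i ≠ 0 := fun h0 => hα (hf α h0)
  exact ⟨α - single i 1, tsub_add_cancel_of_le
    (by simpa [Finsupp.single_le_iff, Nat.one_le_iff_ne_zero] using h0)⟩

theorem majorant_J_le (c : (ℕ →₀ ℕ) → ℝ) (z : ℕ → ℝ) :
    majorant (J c) z ≤ ‖z 0‖ₑ * majorant c z := by
  rw [majorant, tsum_eq_tsum_add_single (i := 0) (fun α h => by simp [J, h]), majorant,
    ← ENNReal.tsum_mul_left]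
  refine ENNReal.tsum_le_tsum fun α => ?_
  rw [← enorm_mul, enorm_le_iff_norm_le]
  simp only [J, Finsupp.add_apply, single_eq_same, add_tsub_cancel_right, monomial_add_single]
  rw [if_neg (by omega)]
  simp only [norm_mul, norm_div]
  have h1 : ‖c α‖ / ‖((α 0 + 1 : ℕ) : ℝ)‖ ≤ ‖c α‖ := div_le_self (norm_nonneg _) (by
    rw [Real.norm_natCast]; push_cast; linarith [(Nat.cast_nonneg (α 0) : (0:ℝ) ≤ α 0)])
  calc _ ≤ ‖c α‖ * (‖monomial z α‖ * ‖z 0‖) := by gcongr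
    _ = _ := by ring

theorem wnorm_J_le {ω : ℕ → ℝ} (hω : ∀ i, 0 < ω i) (c : (ℕ →₀ ℕ) → ℝ) :
    wnorm ω (J c) ≤ ENNReal.ofReal (ω 0) * wnorm ω c := by
  rw [wnorm, tsum_eq_tsum_add_single (i := 0) (fun α h => by simp [J, h]), wnorm,
    ← ENNReal.tsum_mul_left]
  refine ENNReal.tsum_le_tsum fun α => ?_
  rw [← Real.enorm_of_nonneg (hω 0).le, ← enorm_mul, enorm_le_iff_norm_le]
  simp only [J, Finsupp.add_apply, single_eq_same, add_tsub_cancel_right]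
  rw [if_neg (by omega), norm_mul, norm_mul, norm_mul, norm_div, Real.norm_natCast,
    Real.norm_of_nonneg (hω 0).le, Real.norm_of_nonneg (weight_pos hω _).le,
    Real.norm_of_nonneg (weight_pos hω _).le]
  have h := weight_add_single (ω := ω) α 0
  have h2 := weight_pos hω α
  have h3 := hω 0
  have h1 : weight ω (α + single 0 1) ≤ ω 0 * (α 0 + 1) * weight ω α := by
    rw [← h]
    exact le_mul_of_one_le_right (weight_pos hω _).le
      (by linarith [(Nat.cast_nonneg α.degree : (0:ℝ) ≤ α.degree)])
  push_cast
  calc _ ≤ ‖c α‖ / (α 0 + 1) * (ω 0 * (α 0 + 1) * weight ω α) := by gcongr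
    _ = _ := by field_simp

/-- The weight `α! / |α|!` is such that trading a primitive in `t` for a derivative in another
variable is a bounded operation. -/
theorem wnorm_D_J_le {ω : ℕ → ℝ} (hω : ∀ i, 0 < ω i) {i : ℕ} (hi : i ≠ 0)
    (c : (ℕ →₀ ℕ) → ℝ) :
    wnorm ω (D i (J c)) ≤ ENNReal.ofReal (ω 0 / ω i) * wnorm ω c := by
  rw [J_D hi, wnorm, tsum_eq_tsum_add_single (i := 0) (fun α h => by simp [J, h])]
  refine le_trans ?_ (mul_le_mul_right (ENNReal.tsum_comp_le_tsum_of_injective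
    (add_left_injective (single i 1 : ℕ →₀ ℕ)) _) _)
  rw [← ENNReal.tsum_mul_left]
  refine ENNReal.tsum_le_tsum fun α => ?_
  have h3 := hω 0
  have h4 := hω i
  rw [← Real.enorm_of_nonneg (by positivity : 0 ≤ ω 0 / ω i), ← enorm_mul]
  refine le_of_eq (congrArg _ ?_)
  simp only [J, D, Finsupp.add_apply, single_eq_same, add_tsub_cancel_right]
  rw [if_neg (by omega)]
  have h1 := weight_add_single (ω := ω) α 0
  have h2 := weight_add_single (ω := ω) α i
  have hd : (0:ℝ) < α.degree + 1 := by positivity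
  have e1 : weight ω (α + single 0 1) = ω 0 * (α 0 + 1) * weight ω α / (α.degree + 1) := by
    rw [← h1]; field_simp
  have e2 : weight ω (α + single i 1) = ω i * (α i + 1) * weight ω α / (α.degree + 1) := by
    rw [← h2]; field_simp
  rw [e1, e2]
  push_cast
  field_simp

theorem wnorm_J_iterate_le {ω : ℕ → ℝ} (hω : ∀ i, 0 < ω i) (n : ℕ) (c : (ℕ →₀ ℕ) → ℝ) :
    wnorm ω (J^[n] c) ≤ ENNReal.ofReal (ω 0 ^ n) * wnorm ω c := by
  induction n with
  | zero => simp
  | succ n ih =>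
    rw [Function.iterate_succ_apply', pow_succ', ENNReal.ofReal_mul (hω 0).le, mul_assoc]
    exact (wnorm_J_le hω _).trans (by gcongr)

/-- At most `n` derivatives in `x` are compensated by `n` primitives in `t`. -/
theorem wnorm_DL_J_iterate_le {ω : ℕ → ℝ} (hω : ∀ i, 0 < ω i) {μ : ℝ} (hμ : 0 < μ)
    (hμω : ∀ i, i ≠ 0 → μ ≤ ω i) {L : List ℕ} (hL : ∀ i ∈ L, i ≠ 0) {n : ℕ} (hn : L.length ≤ n)
    (c : (ℕ →₀ ℕ) → ℝ) :
    wnorm ω (DL L (J^[n] c)) ≤ ENNReal.ofReal (ω 0 ^ n / μ ^ L.length) * wnorm ω c := by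
  induction L generalizing n c with
  | nil => simpa [DL] using wnorm_J_iterate_le hω n c
  | cons i L ih =>
    obtain ⟨n, rfl⟩ : ∃ k, n = k + 1 := ⟨n - 1, by simp at hn; omega⟩
    have hi := hL i List.mem_cons_self
    have hL' : ∀ j ∈ L, j ≠ 0 := fun j hj => hL j (List.mem_cons_of_mem _ hj)
    have h0 := (hω 0).le
    have h1 := hω i
    have e : D i (J^[n] (J c)) = J^[n] (D i (J c)) :=
      DL_J_iterate (L := [i]) (by simpa using hi) n (J c)
    rw [DL_cons, D_DL, Function.iterate_succ_apply, e]
    refine (ih hL' (n := n) (by simpa using hn) _).trans ?_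
    calc _ ≤ ENNReal.ofReal (ω 0 ^ n / μ ^ L.length)
            * (ENNReal.ofReal (ω 0 / μ) * wnorm ω c) := by
          gcongr
          refine (wnorm_D_J_le hω hi c).trans ?_
          gcongr
          exact hμω i hi
      _ = _ := by
          rw [← mul_assoc, ← ENNReal.ofReal_mul (by positivity), List.length_cons, pow_succ, pow_succ,
            div_mul_div_comm]

/-- The coefficients, up to the order `n` in `t`, determined by the initial data whose
coefficients are `a k`, that is the series of `∑ k < n, t ^ k / k! φ_k`. -/
def initialSeries (a : ℕ → (ℕ →₀ ℕ) → ℝ) : ℕ → (ℕ →₀ ℕ) → ℝ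
  | 0 => 0
  | n + 1 => initialSeries a n + J^[n] (extend (a n))

theorem D_iterate_J_iterate_of_lt {j n : ℕ} (h : n < j) (c : (ℕ →₀ ℕ) → ℝ) :
    (D 0)^[j] (J^[n] (extend c)) = 0 := by
  obtain ⟨k, rfl⟩ := Nat.exists_eq_add_of_lt h
  have e := D_zero_iterate_J n 0 (extend c)
  rw [add_zero, Function.iterate_zero, id] at e
  rw [show n + k + 1 = k + 1 + n by ring, Function.iterate_add_apply, e,
    Function.iterate_succ_apply, D_zero_extend, D_iterate_of_zero]

theorem D_iterate_initialSeries (a : ℕ → (ℕ →₀ ℕ) → ℝ) (n : ℕ) :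
    (D 0)^[n] (initialSeries a n) = 0 := by
  suffices h : ∀ j, n ≤ j → (D 0)^[j] (initialSeries a n) = 0 from h n le_rfl
  induction n with
  | zero => exact fun j _ => D_iterate_of_zero 0 j
  | succ n ih =>
    intro j hj
    rw [initialSeries, D_iterate_add, ih j (by omega), D_iterate_J_iterate_of_lt hj, add_zero]

theorem restrict_J_iterate {n : ℕ} (hn : n ≠ 0) (c : (ℕ →₀ ℕ) → ℝ) : restrict (J^[n] c) = 0 := by
  obtain ⟨k, rfl⟩ := Nat.exists_eq_succ_of_ne_zero hn
  rw [Function.iterate_succ_apply', restrict_J]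

theorem restrict_D_iterate_J_iterate {j n : ℕ} (h : j < n) (c : (ℕ →₀ ℕ) → ℝ) :
    restrict ((D 0)^[j] (J^[n] c)) = 0 := by
  have e := D_zero_iterate_J j (n - j) c
  rw [Nat.add_sub_cancel' h.le] at e
  rw [e, restrict_J_iterate (by omega)]

theorem restrict_D_iterate_initialSeries (a : ℕ → (ℕ →₀ ℕ) → ℝ) {n j : ℕ} (hj : j < n) :
    restrict ((D 0)^[j] (initialSeries a n)) = a j := by
  induction n with
  | zero => omega
  | succ n ih =>
    rw [initialSeries, D_iterate_add, restrict_add]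
    rcases Nat.lt_succ_iff_lt_or_eq.1 hj with h | rfl
    · rw [ih h, restrict_D_iterate_J_iterate h, add_zero]
    · have e := D_zero_iterate_J j 0 (extend (a j))
      rw [add_zero, Function.iterate_zero, id] at e
      rw [D_iterate_initialSeries, e, restrict_extend]
      exact zero_add _

theorem majorant_initialSeries_ne_top {a : ℕ → (ℕ →₀ ℕ) → ℝ} {n : ℕ} {z : ℕ → ℝ}
    (h : ∀ k < n, majorant (a k) (fun i => z (i + 1)) ≠ ⊤) :
    majorant (initialSeries a n) z ≠ ⊤ := by
  have hJ : ∀ (k : ℕ) (c : (ℕ →₀ ℕ) → ℝ), majorant c z ≠ ⊤ → majorant (J^[k] c) z ≠ ⊤ := by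
    intro k c hc
    induction k with
    | zero => exact hc
    | succ k ih =>
      rw [Function.iterate_succ_apply']
      exact ne_top_of_le_ne_top (ENNReal.mul_ne_top enorm_ne_top ih) (majorant_J_le _ _)
  induction n with
  | zero => simp [initialSeries, majorant]
  | succ n ih =>
    refine ne_top_of_le_ne_top (ENNReal.add_ne_top.2 ⟨ih fun k hk => h k (by omega), hJ n _ ?_⟩)
      (majorant_add_le _ _ _)
    exact ne_top_of_le_ne_top (h n (by omega)) (majorant_extend_le _ _)

end Time

/-! ### The jet of a power series -/

section Jet

variable {m : ℕ}

/-- The list of the variables in which `∂_x ^ β ∂_t ^ j` differentiates. -/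
def jetList (b : DerIndex m) : List ℕ := derList Nat.succ b.1.1 ++ List.replicate b.1.2 0

theorem jetList_length_le (b : DerIndex m) : (jetList b).length ≤ m := by
  have := b.2.2.2
  simpa [jetList, derList_length] using this

/-- The coefficients of the entries of the jet of the series with coefficients `c`. -/
def jetCoeff (c : (ℕ →₀ ℕ) → ℝ) : JetIndex m → (ℕ →₀ ℕ) → ℝ
  | .time => fun α => if α = single 0 1 then 1 else 0
  | .space i => fun α => if α = single (i + 1) 1 then 1 else 0
  | .value => c
  | .der b => DL (jetList b) c

theorem hasSum_coordinate (i : ℕ) (z : ℕ → ℝ) :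
    HasSum (fun α => (if α = single i 1 then 1 else 0) * monomial z α) (z i) := by
  have := hasSum_single (f := fun α => (if α = single i 1 then 1 else 0) * monomial z α)
    (single i 1) (fun α hα => by simp [hα])
  simpa [monomial] using this

theorem represents_jet {S : Set (ℕ → ℝ)} (hS : CoordOpen S) {c : (ℕ →₀ ℕ) → ℝ}
    {u : (ℕ → ℝ) → ℝ} (h : Represents S c u) (a : JetIndex m) :
    Represents S (jetCoeff c a) fun z => jet m u z a := by
  cases a with
  | time => exact fun z _ => hasSum_coordinate 0 z
  | space i => exact fun z _ => hasSum_coordinate (i + 1) z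
  | value => exact h
  | der b =>
    have := h.foldr hS (jetList b)
    simpa only [jet, jetCoeff, multiPartial_eq_foldr, jetList, List.foldr_append, foldr_replicate]
      using this

/-- The point at which the right-hand side is expanded is the jet at `0` of every series with the
given initial data. -/
theorem jetCenter_eq (hm : 0 < m) {φ : ℕ → (ℕ → ℝ) → ℝ} {a : ℕ → (ℕ →₀ ℕ) → ℝ}
    {S : ℕ → Set (ℕ → ℝ)} (hS : ∀ k < m, CoordOpen (S k)) (h0 : ∀ k < m, (0 : ℕ → ℝ) ∈ S k)
    (ha : ∀ k < m, Represents (S k) (a k) (φ k)) {c : (ℕ →₀ ℕ) → ℝ}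
    (hc : ∀ k < m, restrict ((D 0)^[k] c) = a k) (i : JetIndex m) :
    jetCenter m φ i = jetCoeff c i 0 := by
  cases i with
  | time => simp [jetCenter, jetCoeff, (Finsupp.single_ne_zero.2 one_ne_zero).symm]
  | space i => simp [jetCenter, jetCoeff, (Finsupp.single_ne_zero.2 one_ne_zero).symm]
  | value =>
    simp only [jetCenter, jetCoeff]
    rw [(ha 0 hm).apply_zero (h0 0 hm), ← hc 0 hm]
    simp [restrict]
  | der b =>
    have hb := b.2.1
    simp only [jetCenter, jetCoeff, jetList]
    rw [multiPartial_eq_foldr, ((ha _ hb).foldr (hS _ hb) _).apply_zero (h0 _ hb), ← hc _ hb,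
      ← restrict_DL, DL_append, DL_replicate, ← derList_succ]
    simp [restrict]

end Jet

/-! ### Points near infinity -/

section NearInfty

/-- The coordinates of a point near infinity are bounded away from `0`. -/
theorem IsNearInfty.exists_le {ι : Type*} {p : ℝ} (hp : 0 < p) {v : ι → ℝ}
    (h : IsNearInfty p v) : ∃ μ > 0, ∀ i, μ ≤ |v i| := by
  obtain ⟨h0, hs⟩ := h
  have hnn : ∀ i, 0 ≤ 1 / |v i| ^ p := fun i => by positivity
  set T := ∑' i, 1 / |v i| ^ p with hT
  have hT0 : 0 ≤ T := tsum_nonneg hnn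
  refine ⟨(T + 1)⁻¹ ^ p⁻¹, by positivity, fun i => ?_⟩
  have hv := abs_pos.2 (h0 i)
  have h1 : 1 / |v i| ^ p ≤ T + 1 := (hs.le_tsum i fun j _ => hnn j).trans (by linarith)
  have h2 : (T + 1)⁻¹ ≤ |v i| ^ p := by
    rw [one_div] at h1
    exact inv_le_of_inv_le₀ (by positivity) h1
  calc (T + 1)⁻¹ ^ p⁻¹ ≤ (|v i| ^ p) ^ p⁻¹ := by gcongr
    _ = |v i| := Real.rpow_rpow_inv hv.le hp.ne'

/-- Finitely many points near infinity dominate a common one. -/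
theorem exists_near_infty_le {p : ℝ} {n : ℕ} {v : ℕ → ℕ → ℝ}
    (hv : ∀ k < n, IsNearInfty p (v k)) {v' : ℕ → ℝ} (hv' : IsNearInfty p v') :
    ∃ w : ℕ → ℝ, (∀ i, 0 < w i) ∧ (Summable fun i => 1 / |w i| ^ p) ∧
      (∀ i, w i ≤ |v' i|) ∧ ∀ k < n, ∀ i, w i ≤ |v k i| := by
  induction n with
  | zero => exact ⟨fun i => |v' i|, fun i => abs_pos.2 (hv'.1 i), by simpa using hv'.2,
      fun i => le_rfl, by simp⟩
  | succ n ih =>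
    obtain ⟨w, h1, h2, h3, h4⟩ := ih fun k hk => hv k (by omega)
    obtain ⟨h5, h6⟩ := hv n (by omega)
    refine ⟨fun i => min (w i) |v n i|, fun i => lt_min (h1 i) (abs_pos.2 (h5 i)), ?_,
      fun i => (min_le_left _ _).trans (h3 i), fun k hk i => ?_⟩
    · refine Summable.of_nonneg_of_le (fun i => by positivity) (fun i => ?_) (h2.add h6)
      rw [abs_of_pos (lt_min (h1 i) (abs_pos.2 (h5 i)))]
      rcases min_cases (w i) |v n i| with ⟨e, -⟩ | ⟨e, -⟩
      · rw [e, abs_of_pos (h1 i)]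
        have : 0 ≤ 1 / |v n i| ^ p := by positivity
        linarith
      · rw [e]
        have : 0 ≤ 1 / |w i| ^ p := by positivity
        linarith
    · rcases Nat.lt_succ_iff_lt_or_eq.1 hk with h | rfl
      · exact (min_le_left _ _).trans (h4 k h i)
      · exact min_le_right _ _

theorem coordOpen_box (v : ℕ → ℝ) : CoordOpen {z | ∀ i, |z i| < |v i|} := by
  intro z hz i
  refine ⟨(|v i| - |z i|) / 2, by linarith [hz i], fun s hs j => ?_⟩
  by_cases hj : j = i
  · subst hj; simp only [Function.update_self]; linarith [hz j]
  · simpa [hj] using hz j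

theorem HasMonomialExpansion.represents {E : Set (ℕ → ℝ)} {φ : (ℕ → ℝ) → ℝ}
    {c : (ℕ →₀ ℕ) → ℝ} {v : ℕ → ℝ} (h : HasMonomialExpansion E φ 0 c v) :
    Represents {z | ∀ i, |z i| < |v i|} c φ := fun z hz => by
  simpa using (h.2.2 z fun i => (hz i).le).2

end NearInfty

/-! ### Existence -/

section Existence

variable {m : ℕ}

/-- The sequence of the coordinates of the point `(t, x)`. -/
def cons (t : ℝ) (x : ℕ → ℝ) : ℕ → ℝ
  | 0 => t
  | i + 1 => x i

/-- An additive operation on series which is bounded for the weighted norm acts on the algebra of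
series of finite norm. -/
theorem WeightedSeries.exists_addMonoidHom {ω : ℕ → {x : ℝ // 0 < x}}
    (T : ((ℕ →₀ ℕ) → ℝ) → (ℕ →₀ ℕ) → ℝ) (hT : ∀ c d, T (c + d) = T c + T d) {K : ℝ} (hK : 0 ≤ K)
    (h : ∀ W : WeightedSeries ω,
      wnorm (fun i => ω i) (T (WeightedSeries.coeffs W)) ≤ ENNReal.ofReal (K * ‖W‖)) :
    ∃ Λ : WeightedSeries ω →+ WeightedSeries ω, ∀ W,
      WeightedSeries.coeffs (Λ W) = T (WeightedSeries.coeffs W) ∧ ‖Λ W‖ ≤ K * ‖W‖ := by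
  have htop := fun W => ne_top_of_le_ne_top ENNReal.ofReal_ne_top (h W)
  refine ⟨AddMonoidHom.mk' (fun W => WeightedSeries.mk _ (htop W)) fun W W' => ?_,
    fun W => ⟨rfl, WeightedSeries.norm_le_of_wnorm_le (by positivity) (h W)⟩⟩
  apply WeightedSeries.coeffs_injective
  have e := WeightedSeries.coeffs_add (WeightedSeries.mk _ (htop W)) (WeightedSeries.mk _ (htop W'))
  rw [e, WeightedSeries.coeffs_mk, WeightedSeries.coeffs_mk, WeightedSeries.coeffs_mk,
    WeightedSeries.coeffs_add, hT]

/-- A uniform bound for the nonconstant parts of the derivatives of a series, which is moreover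
small near `0`. -/
theorem exists_majorant_DL_sub_const_le {c : (ℕ →₀ ℕ) → ℝ} {y : ℕ → ℝ} {μ : ℝ} (hμ : 0 < μ)
    (hy : ∀ i, μ ≤ y i) (hc : majorant c y ≠ ⊤) (n : ℕ) :
    ∃ C : ℝ, 0 ≤ C ∧ ∀ L : List ℕ, L.length ≤ n → ∀ l : ℝ, 0 ≤ l → l ≤ 1 →
      majorant (DL L c - fun α => if α = 0 then DL L c 0 else 0) (l • fun i => y i / 2)
        ≤ ENNReal.ofReal (l * C) := by
  obtain ⟨η, hη0, hη1, hηn⟩ := exists_mul_natCast_le (half_pos hμ) n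
  set C : ℝ≥0∞ := (ENNReal.ofReal (η ^ n))⁻¹ * majorant c y with hC
  have hpow : ENNReal.ofReal (η ^ n) ≠ 0 := by
    rw [Ne, ENNReal.ofReal_eq_zero, not_le]; positivity
  have hCtop : C ≠ ⊤ := ENNReal.mul_ne_top (ENNReal.inv_ne_top.2 hpow) hc
  refine ⟨C.toReal, ENNReal.toReal_nonneg, fun L hL l hl0 hl1 => ?_⟩
  have hhalf : majorant (DL L c) (fun i => y i / 2) ≤ C := by
    refine majorant_DL_le_of_length_le c hη0 hη1 hL fun j => ?_
    have hj : (L.count j : ℝ) ≤ n := by exact_mod_cast (List.count_le_length).trans hL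
    have h2 : η * L.count j ≤ η * n := by gcongr
    have h3 := hy j
    rw [abs_of_pos (by linarith), abs_of_pos (by linarith)]
    linarith
  refine (majorant_smul_le (by simp) hl0 hl1 _).trans ?_
  rw [ENNReal.ofReal_mul hl0, ENNReal.ofReal_toReal hCtop]
  gcongr
  exact (majorant_sub_const_le _ _).trans hhalf

/-- The dependence of the jet on the unknown `W = ∂_t ^ m u`. -/
def jetLinear (c : (ℕ →₀ ℕ) → ℝ) : JetIndex m → (ℕ →₀ ℕ) → ℝ
  | .time => 0
  | .space _ => 0
  | .value => J^[m] c
  | .der b => DL (jetList b) (J^[m] c)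

theorem jetCoeff_add (c d : (ℕ →₀ ℕ) → ℝ) (a : JetIndex m) :
    jetCoeff (c + J^[m] d) a = jetCoeff c a + jetLinear d a := by
  cases a with
  | time => exact (add_zero _).symm
  | space i => exact (add_zero _).symm
  | value => rfl
  | der b => exact DL_add _ _ _

theorem jetLinear_add (c d : (ℕ →₀ ℕ) → ℝ) (a : JetIndex m) :
    jetLinear (c + d) a = jetLinear c a + jetLinear d a := by
  cases a with
  | time => exact (add_zero _).symm
  | space i => exact (add_zero _).symm
  | value => exact J_iterate_add _ _ _
  | der b => simp only [jetLinear]; rw [J_iterate_add, DL_add]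

/-- A small weight of `t` makes the jet depend weakly on `∂_t ^ m u`, as every entry of the jet has
fewer than `m` derivatives in `t`. -/
theorem wnorm_jetLinear_le (hm : 0 < m) {ω : ℕ → ℝ} (hω : ∀ i, 0 < ω i) (hω0 : ω 0 ≤ 1) {μ : ℝ}
    (hμ : 0 < μ) (hμ1 : μ ≤ 1) (hμω : ∀ i, i ≠ 0 → μ ≤ ω i) (c : (ℕ →₀ ℕ) → ℝ) (a : JetIndex m) :
    wnorm ω (jetLinear c a) ≤ ENNReal.ofReal (ω 0 / μ ^ m) * wnorm ω c := by
  have key : ∀ L : List ℕ, (∀ i ∈ L, i ≠ 0) → ∀ n, 1 ≤ n → n ≤ m → L.length ≤ n →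
      wnorm ω (DL L (J^[n] c)) ≤ ENNReal.ofReal (ω 0 / μ ^ m) * wnorm ω c := by
    intro L hL n hn hnm hLn
    refine (wnorm_DL_J_iterate_le hω hμ hμω hL hLn c).trans ?_
    have h0 := (hω 0).le
    gcongr ENNReal.ofReal ?_ * _
    have h1 : ω 0 ^ n ≤ ω 0 := pow_le_of_le_one h0 hω0 (by omega)
    have h2 : μ ^ m ≤ μ ^ L.length := pow_le_pow_of_le_one hμ.le hμ1 (hLn.trans hnm)
    gcongr
  cases a with
  | time => simp [jetLinear, wnorm]
  | space i => simp [jetLinear, wnorm]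
  | value => exact key [] (by simp) m hm le_rfl (by simp)
  | der b =>
    have hb1 := b.2.1
    have hb2 := b.2.2.2
    have e := D_zero_iterate_J b.1.2 (m - b.1.2) c
    rw [Nat.add_sub_cancel' hb1.le] at e
    simp only [jetLinear, jetList]
    rw [DL_append, DL_replicate, e]
    refine key _ (fun i hi => ?_) _ (by omega) (by omega) ?_
    · rw [derList_succ] at hi
      obtain ⟨j, -, rfl⟩ := List.mem_map.1 hi
      exact Nat.succ_ne_zero j
    · rw [derList_length]; omega

/-- In the unknown `W = ∂_t ^ m u` the Cauchy problem is the equation `W = f (jet (P + J ^ m W))`,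
where `P` is given by the initial data; it is solved in the algebra `WeightedSeries ω`. -/
theorem exists_isLocalAnalyticSolution (hm : 0 < m) {p : ℝ} (hp : 1 ≤ p)
    {q : ℝ≥0∞} [Fact (1 ≤ q)] (hpq : (ENNReal.ofReal p).HolderConjugate q)
    {D' : Set (JetIndex m → ℝ)} {f : (JetIndex m → ℝ) → ℝ}
    {E : ℕ → Set (ℕ → ℝ)} {φ : ℕ → (ℕ → ℝ) → ℝ}
    (hφ : ∀ k < m, AnalyticNearInfty p (E k) (φ k) 0)
    (hf : AnalyticNearInfty p D' f (jetCenter m φ)) :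
    ∃ (r : ℝ) (u : (ℕ → ℝ) → ℝ), IsLocalAnalyticSolution m q D' f E φ r u := by
  have hp0 : 0 < p := by linarith
  obtain ⟨cf, vf, ⟨hvf0, hvfs, hvf⟩, hvfn⟩ := hf
  choose! cφ vφ hφ using hφ
  obtain ⟨ν, hν, hνv⟩ := hvfn.exists_le hp0
  have hvx : IsNearInfty p fun i => vf (.space i) := by
    refine ⟨fun i => hvf0 _, ?_⟩
    exact hvfn.2.comp_injective (i := JetIndex.space) fun i j h => by simpa using h
  obtain ⟨w, hw0, hws, hwf, hwφ⟩ := exists_near_infty_le (fun k hk => (hφ k hk).2) hvx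
  obtain ⟨μ, hμ, hμw⟩ := IsNearInfty.exists_le hp0 (v := w) ⟨fun i => (hw0 i).ne', hws⟩
  have hμw : ∀ i, μ ≤ w i := fun i => by simpa [abs_of_pos (hw0 i)] using hμw i
  -- the part of the solution that is determined by the initial data alone
  set P := initialSeries cφ m with hP
  let y : ℕ → ℝ := cons 1 w
  have hPtop : majorant P y ≠ ⊤ := by
    refine majorant_initialSeries_ne_top fun k hk => ?_
    have h1 := summable_iff_majorant.1 (summable_abs_iff.1 (hφ k hk).1.2.1)
    refine ne_top_of_le_ne_top h1 (majorant_mono fun i => ?_)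
    show |w i| ≤ _
    rw [abs_of_pos (hw0 i)]
    exact hwφ k hk i
  obtain ⟨C, hC0, hC⟩ := exists_majorant_DL_sub_const_le (c := P) (y := y) (μ := min 1 μ) (by positivity)
    (by
      rintro (_ | i)
      · exact min_le_left _ _
      · exact (min_le_right _ _).trans (hμw i)) hPtop m
  set M := ∑' α, |cf α * monomial (fun a => |vf a|) α| with hM
  have hM0 : 0 ≤ M := tsum_nonneg fun _ => abs_nonneg _
  -- first the weights of the variables `x` are shrunk by the factor `l`, which makes the
  -- contribution of the initial data small, then the weight `ρ` of `t` is chosen still smaller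
  set l := min (1 / 2) (ν / (4 * (C + 1))) with hl
  have hl0 : 0 < l := by positivity
  have hl1 : l ≤ 1 / 2 := min_le_left _ _
  have hlC : l * C ≤ ν / 4 := by
    have h1 : l ≤ ν / (4 * (C + 1)) := min_le_right _ _
    rw [le_div_iff₀ (by positivity)] at h1
    nlinarith
  set μ' := min 1 (l * (μ / 2)) with hμ'
  have hμ'0 : 0 < μ' := by positivity
  set ρ := min (l / 2) (min (ν / 4) (μ' ^ m * (ν / (4 * (M + 1))))) with hρ
  have hρ0 : 0 < ρ := by positivity
  have hρl : ρ ≤ l / 2 := min_le_left _ _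
  have hρν : ρ ≤ ν / 4 := (min_le_right _ _).trans (min_le_left _ _)
  have hρM : ρ / μ' ^ m ≤ ν / (4 * (M + 1)) := by
    rw [div_le_iff₀ (by positivity), mul_comm]
    exact (min_le_right _ _).trans (min_le_right _ _)
  let ωr : ℕ → ℝ := cons ρ fun i => l * (w i / 2)
  have hωr : ∀ i, 0 < ωr i := by
    rintro (_ | i)
    · exact hρ0
    · have := hw0 i
      show 0 < l * (w i / 2)
      positivity
  let ω : ℕ → {x : ℝ // 0 < x} := fun i => ⟨ωr i, hωr i⟩
  have hωy : ∀ i, |ωr i| ≤ |(l • fun i => y i / 2) i| := by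
    intro i
    refine abs_le_abs_of_nonneg (hωr i).le ?_
    cases i with
    | zero =>
      show ρ ≤ l * (1 / 2)
      linarith
    | succ i => exact le_rfl
  -- the jet of a solution, centred at the point of expansion of `f`
  have hg : ∀ a : JetIndex m, ∃ g : WeightedSeries ω,
      WeightedSeries.coeffs g = jetCoeff P a - (fun α => if α = 0 then jetCoeff P a 0 else 0) ∧
      ‖g‖ ≤ |vf a| / 4 := by
    intro a
    suffices h : wnorm ωr (jetCoeff P a - (fun α => if α = 0 then jetCoeff P a 0 else 0))
        ≤ ENNReal.ofReal (|vf a| / 4) from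
      ⟨WeightedSeries.mk _ (ne_top_of_le_ne_top ENNReal.ofReal_ne_top h), rfl,
        WeightedSeries.norm_le_of_wnorm_le (by positivity) h⟩
    have hX : ∀ i, wnorm ωr ((fun α => if α = single i 1 then 1 else 0)
        - fun α => if α = 0 then (if (0 : ℕ →₀ ℕ) = single i 1 then (1:ℝ) else 0) else 0)
        = ENNReal.ofReal (ωr i) := by
      intro i
      have e : ((fun α => if α = single i 1 then 1 else 0)
          - fun α => if α = 0 then (if (0 : ℕ →₀ ℕ) = single i 1 then (1:ℝ) else 0) else 0)
          = fun α : ℕ →₀ ℕ => if α = single i 1 then (1:ℝ) else 0 := by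
        funext α
        simp [(Finsupp.single_ne_zero.2 one_ne_zero).symm]
      rw [e, wnorm_single, one_mul, weight_single, Real.enorm_of_nonneg (hωr i).le]
    have hL : ∀ L : List ℕ, L.length ≤ m →
        wnorm ωr (DL L P - fun α => if α = 0 then DL L P 0 else 0)
          ≤ ENNReal.ofReal (|vf a| / 4) := by
      intro L hL
      refine (wnorm_le_majorant hωr _).trans ((majorant_mono hωy).trans ?_)
      refine (hC L hL l hl0.le (by linarith)).trans (ENNReal.ofReal_le_ofReal ?_)
      have := hνv a
      linarith
    cases a with
    | time =>
      refine (hX 0).trans_le (ENNReal.ofReal_le_ofReal ?_)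
      have := hνv .time
      show ρ ≤ _
      linarith
    | space i =>
      refine (hX (i + 1)).trans_le (ENNReal.ofReal_le_ofReal ?_)
      have h1 := hwf i
      have h2 := hw0 i
      show l * (w i / 2) ≤ _
      nlinarith
    | value => exact hL [] (by simp)
    | der b => exact hL _ (jetList_length_le b)
  choose g hgc hgn using hg
  have hΛ : ∀ a : JetIndex m, ∃ Λ : WeightedSeries ω →+ WeightedSeries ω, ∀ W,
      WeightedSeries.coeffs (Λ W) = jetLinear (WeightedSeries.coeffs W) a ∧
      ‖Λ W‖ ≤ |vf a| / (4 * (M + 1)) * ‖W‖ := by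
    intro a
    have h : ∀ W : WeightedSeries ω, wnorm ωr (jetLinear (WeightedSeries.coeffs W) a)
        ≤ ENNReal.ofReal (|vf a| / (4 * (M + 1)) * ‖W‖) := by
      intro W
      refine (wnorm_jetLinear_le hm hωr (μ := μ') (by show ρ ≤ 1; linarith) hμ'0
        (min_le_left _ _) ?_ _ a).trans ?_
      · rintro (_ | i) hi
        · exact absurd rfl hi
        · have := hμw i
          refine (min_le_right _ _).trans ?_
          show l * (μ / 2) ≤ l * (w i / 2)
          gcongr
      · rw [ENNReal.ofReal_mul (by positivity)]
        refine mul_le_mul' (ENNReal.ofReal_le_ofReal ?_) (WeightedSeries.ofReal_norm W).symm.le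
        refine hρM.trans ?_
        have := hνv a
        gcongr
    exact WeightedSeries.exists_addMonoidHom (ω := ω) (K := |vf a| / (4 * (M + 1)))
      (fun c => jetLinear c a) (fun c d => jetLinear_add c d a) (by positivity) h
  choose Λ hΛ using hΛ
  have hvfs' : Summable fun α => |cf α * monomial (fun a => |vf a|) α| := by
    refine hvfs.congr fun α => ?_
    rw [abs_mul, abs_mul, abs_monomial, abs_monomial]
    simp
  obtain ⟨W, hWn, hW⟩ := exists_eq_tsum_prod_pow (fun a => abs_pos.2 (hvf0 a)) hvfs' g Λ hgn
    fun a W => (hΛ a W).2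
  set W' := WeightedSeries.coeffs W with hW'
  set c := P + J^[m] W' with hc
  have hres : ∀ k < m, restrict ((D 0)^[k] c) = cφ k := by
    intro k hk
    rw [hc, D_iterate_add, restrict_add, hP, restrict_D_iterate_initialSeries cφ hk,
      restrict_D_iterate_J_iterate hk, add_zero]
  have hDm : (D 0)^[m] c = W' := by
    have e := D_zero_iterate_J m 0 W'
    rw [hc, D_iterate_add, hP, D_iterate_initialSeries, zero_add]
    exact e
  have hcenter := fun a => jetCenter_eq hm (fun k _ => coordOpen_box (vφ k))
    (fun k hk i => by simpa using (hφ k hk).1.1 i) (fun k hk => (hφ k hk).1.represents)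
    (fun k hk => restrict_D_iterate_initialSeries cφ hk) a
  obtain ⟨r, hr, hadm⟩ := exists_lpBall_admissible hp hpq hωr (by
    rw [← summable_nat_add_iff 1]
    refine (hws.mul_left (1 / (l / 2) ^ p)).congr fun i => ?_
    show 1 / (l / 2) ^ p * (1 / |w i| ^ p) = 1 / |l * (w i / 2)| ^ p
    have hlw : 0 < l * (w i / 2) := hωr (i + 1)
    rw [abs_of_pos (hw0 i), abs_of_pos hlw,
      show l * (w i / 2) = l / 2 * w i by ring, Real.mul_rpow (by positivity) (hw0 i).le,
      one_div_mul_one_div])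
  have hadm' : ∀ z ∈ lpBall q r, ∀ i, |z i| ≤ ωr i := by
    intro z hz i
    have := hadm z hz {i}
    rwa [Finset.sum_singleton, div_le_one (hωr i)] at this
  have hctop : ∀ z ∈ lpBall q r, majorant c z ≠ ⊤ := by
    intro z hz
    refine ne_top_of_le_ne_top (ENNReal.add_ne_top.2 ⟨?_, ?_⟩) (majorant_add_le _ _ _)
    · refine ne_top_of_le_ne_top hPtop (majorant_mono fun i => ?_)
      refine (hadm' z hz i).trans ?_
      cases i with
      | zero =>
        show ρ ≤ |(1 : ℝ)|
        rw [abs_one]; linarith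
      | succ i =>
        show l * (w i / 2) ≤ |w i|
        rw [abs_of_pos (hw0 i)]
        nlinarith [hw0 i]
    · refine ne_top_of_le_ne_top ?_ (majorant_le_wnorm hωr (hadm z hz) _)
      exact ne_top_of_le_ne_top (ENNReal.mul_ne_top ENNReal.ofReal_ne_top
        (WeightedSeries.wnorm_ne_top W)) (wnorm_J_iterate_le hωr m W')
  have hS := coordOpen_lpBall (q := q) r
  set u : (ℕ → ℝ) → ℝ := fun z => ∑' α, c α * monomial z α with hu
  have hrep : Represents (lpBall q r) c u := represents_of_majorant hctop
  refine ⟨r, u, hr, ?_, ?_, ?_, ?_⟩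
  · obtain ⟨v, hv, hv0⟩ := exists_pos_mem_lpBall (q := q) hr
    refine ⟨c, ⟨v, fun i => (hv0 i).ne', (hrep v hv).summable.abs, fun h hh => ?_⟩, hrep⟩
    have := lpBall_solid hv hh
    rw [zero_add]
    exact ⟨this, hrep h this⟩
  · intro L _ i z hz
    exact ((hrep.foldr hS L).hasDerivAt hS hz i).2.differentiableAt
  · intro z hz
    set h : JetIndex m → ℝ := fun a => WeightedSeries.eval (ω := ω) z (hadm z hz) (g a + Λ a W)
      with hh
    have hjet : jet m u z = jetCenter m φ + h := by
      funext a
      have h1 := represents_jet hS hrep a z hz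
      have h2 := WeightedSeries.hasSum_eval (hadm z hz) (g a + Λ a W)
      rw [WeightedSeries.coeffs_add, hgc, (hΛ a W).1] at h2
      rw [Pi.add_apply, hcenter a]
      refine h1.unique (((hasSum_const (jetCoeff P a 0) z).add h2).congr_fun fun α => ?_)
      rw [hc, jetCoeff_add]
      simp only [Pi.add_apply, Pi.sub_apply]
      ring
    have hbox : ∀ a, |h a| ≤ |vf a| := fun a =>
      (WeightedSeries.abs_eval_le (hadm z hz) _).trans ((hWn a).trans (by linarith [abs_nonneg (vf a)]))
    obtain ⟨h1, h2⟩ := hvf h hbox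
    rw [hjet]
    refine ⟨h1, ?_⟩
    have h3 := hW.map (WeightedSeries.eval (ω := ω) z (hadm z hz))
      (WeightedSeries.continuous_eval (hadm z hz))
    have h4 : HasSum (fun α => cf α * monomial h α) (WeightedSeries.eval (ω := ω) z (hadm z hz) W) := by
      refine h3.congr_fun fun α => ?_
      simp only [Function.comp_apply, map_smul, smul_eq_mul, monomial, Finsupp.prod, map_prod,
        map_pow, hh]
    rw [h2.unique h4]
    have h5 := hrep.iterate hS 0 m z hz
    rw [hDm] at h5
    exact h5.unique (WeightedSeries.hasSum_eval (hadm z hz) W)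
  · intro k hk z hz hz0
    have hx : ∀ i, |z (i + 1)| ≤ |vφ k i| := fun i => by
      refine (hadm' z hz (i + 1)).trans (le_trans ?_ (hwφ k hk i))
      show l * (w i / 2) ≤ w i
      nlinarith [hw0 i]
    obtain ⟨h1, h2⟩ := (hφ k hk).1.2.2 (fun i => z (i + 1)) hx
    rw [zero_add] at h1 h2
    refine ⟨h1, ?_⟩
    have h3 := hasSum_restrict hz0 (hrep.iterate hS 0 k z hz)
    rw [hres k hk] at h3
    exact h3.unique h2

end Existence

/-! ### The order of vanishing in time -/

section TimeOrder

/-- All the terms of the series with coefficients `c` contain at least the power `t ^ k`. -/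
def VanishesBelow (k : ℕ) (c : (ℕ →₀ ℕ) → ℝ) : Prop := ∀ α : ℕ →₀ ℕ, α 0 < k → c α = 0

theorem VanishesBelow.mono {j k : ℕ} (hjk : j ≤ k) {c : (ℕ →₀ ℕ) → ℝ} (h : VanishesBelow k c) :
    VanishesBelow j c := fun α hα => h α (hα.trans_le hjk)

/-- Each differentiation in `t` costs one power of `t`. -/
theorem VanishesBelow.D_zero_iterate {k : ℕ} (n : ℕ) {c : (ℕ →₀ ℕ) → ℝ}
    (h : VanishesBelow (k + n) c) : VanishesBelow k ((D 0)^[n] c) := by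
  induction n generalizing c with
  | zero => exact h
  | succ n ih =>
    rw [Function.iterate_succ_apply]
    refine ih fun α hα => ?_
    simp only [D]
    rw [h _ (by simp; omega), mul_zero]

theorem VanishesBelow.DL_of_ne_zero {k : ℕ} {L : List ℕ} (hL : ∀ i ∈ L, i ≠ 0)
    {c : (ℕ →₀ ℕ) → ℝ} (h : VanishesBelow k c) : VanishesBelow k (DL L c) := by
  induction L with
  | nil => exact h
  | cons i L ih =>
    have h1 := ih fun j hj => hL j (List.mem_cons_of_mem _ hj)
    have h2 : i ≠ 0 := hL i List.mem_cons_self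
    intro α hα
    rw [DL_cons]
    simp only [D]
    rw [h1 _ (by simpa [h2.symm] using hα), mul_zero]

theorem vanishesBelow_succ {k : ℕ} {c : (ℕ →₀ ℕ) → ℝ} (h0 : restrict c = 0)
    (h : VanishesBelow k (D 0 c)) : VanishesBelow (k + 1) c := by
  intro α hα
  rcases Nat.eq_zero_or_pos (α 0) with h1 | h1
  · rw [← spaceIndex_tail h1]
    exact congrFun h0 (tail α)
  · have e : α - single 0 1 + single 0 1 = α := tsub_add_cancel_of_le
      (by simpa [Finsupp.single_le_iff, Nat.one_le_iff_ne_zero] using h1.ne')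
    have h2 := h (α - single 0 1) (by simp; omega)
    simp only [D] at h2
    rw [e] at h2
    exact (mul_eq_zero.1 h2).resolve_left (by positivity)

theorem vanishesBelow_add {k n : ℕ} {c : (ℕ →₀ ℕ) → ℝ}
    (h0 : ∀ j < n, restrict ((D 0)^[j] c) = 0) (h : VanishesBelow k ((D 0)^[n] c)) :
    VanishesBelow (k + n) c := by
  induction n generalizing c with
  | zero => exact h
  | succ n ih =>
    refine vanishesBelow_succ (h0 0 (by omega)) (ih (fun j hj => ?_) ?_)
    · exact h0 (j + 1) (by omega)
    · exact h

/-- The equation contains fewer than `m` derivatives in `t` on its right-hand side, which gains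
one power of `t`. -/
theorem VanishesBelow.DL_jetList {m l : ℕ} {c : (ℕ →₀ ℕ) → ℝ} (h : VanishesBelow (l + m) c)
    (b : DerIndex m) : VanishesBelow (l + 1) (DL (jetList b) c) := by
  rw [jetList, DL_append, DL_replicate]
  have hb := b.2.1
  refine VanishesBelow.DL_of_ne_zero (fun i hi => ?_)
    (VanishesBelow.D_zero_iterate b.1.2 (h.mono (by omega)))
  rw [derList_succ] at hi
  obtain ⟨j, -, rfl⟩ := List.mem_map.1 hi
  exact Nat.succ_ne_zero j

theorem monomial_update_mul (z : ℕ → ℝ) (i : ℕ) (τ : ℝ) (α : ℕ →₀ ℕ) :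
    monomial (Function.update z i (τ * z i)) α = τ ^ α i * monomial z α := by
  rw [monomial_update, monomial_eq_erase z α i, mul_pow, mul_assoc]

theorem hasSum_sub_coeff {c d : (ℕ →₀ ℕ) → ℝ} {z : ℕ → ℝ} {s t : ℝ}
    (hc : HasSum (fun α => c α * monomial z α) s) (hd : HasSum (fun α => d α * monomial z α) t) :
    HasSum (fun α => (c - d) α * monomial z α) (s - t) :=
  (hc.sub hd).congr_fun fun α => by rw [Pi.sub_apply, sub_mul]

theorem abs_le_of_hasSum {c : (ℕ →₀ ℕ) → ℝ} {z : ℕ → ℝ} {s C : ℝ}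
    (h : HasSum (fun α => c α * monomial z α) s) (hC : 0 ≤ C)
    (hm : majorant c z ≤ ENNReal.ofReal C) : |s| ≤ C := by
  have h1 : ‖s‖ₑ ≤ ENNReal.ofReal C := by
    rw [← h.tsum_eq]
    exact enorm_tsum_le_tsum_enorm.trans hm
  rwa [← Real.enorm_of_nonneg hC, enorm_le_iff_norm_le, Real.norm_of_nonneg hC] at h1

/-- A series in which every term contains `t ^ k` is of size `O(t ^ k)`. -/
theorem VanishesBelow.majorant_le {k : ℕ} {c : (ℕ →₀ ℕ) → ℝ} (h : VanishesBelow k c)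
    {τ : ℝ} (h0 : 0 ≤ τ) (h1 : τ ≤ 1) (z : ℕ → ℝ) :
    majorant c (Function.update z 0 (τ * z 0)) ≤ ENNReal.ofReal (τ ^ k) * majorant c z := by
  rw [majorant, majorant, ← ENNReal.tsum_mul_left]
  refine ENNReal.tsum_le_tsum fun α => ?_
  rw [← Real.enorm_of_nonneg (pow_nonneg h0 k), ← enorm_mul, enorm_le_iff_norm_le]
  rcases lt_or_ge (α 0) k with hα | hα
  · simp [h α hα]
  · rw [monomial_update_mul, mul_left_comm, norm_mul, norm_mul (τ ^ k)]
    gcongr ?_ * _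
    rw [Real.norm_of_nonneg (by positivity), Real.norm_of_nonneg (by positivity)]
    exact pow_le_pow_of_le_one h0 h1 hα

end TimeOrder

/-! ### Uniqueness -/

section Uniqueness

variable {q : ℝ≥0∞} [Fact (1 ≤ q)] {m : ℕ}

/-- The coefficients of a solution that do not involve `t` after at most `m - 1` differentiations
in `t` are those of the initial data. -/
theorem restrict_D_iterate_eq {r : ℝ} (hr : 0 < r) {c a : (ℕ →₀ ℕ) → ℝ} {u ψ : (ℕ → ℝ) → ℝ}
    (hu : Represents (lpBall q r) c u) {S : Set (ℕ → ℝ)} (hS : CoordOpen S)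
    (h0 : (0 : ℕ → ℝ) ∈ S) (ha : Represents S a ψ) {k : ℕ}
    (h : ∀ z ∈ lpBall q r, z 0 = 0 →
      (InfCK.partialDeriv 0)^[k] u z = ψ fun i => z (i + 1)) :
    restrict ((D 0)^[k] c) = a := by
  have hT : CoordOpen {x | cons 0 x ∈ lpBall q r} := by
    intro x hx i
    obtain ⟨δ, hδ, hδ'⟩ := coordOpen_lpBall r _ hx (i + 1)
    refine ⟨δ, hδ, fun s hs => ?_⟩
    have e : Function.update (cons 0 x) (i + 1) s = cons 0 (Function.update x i s) := by
      funext j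
      cases j with
      | zero => simp [cons]
      | succ j => by_cases hj : j = i <;> simp [cons, Function.update, hj]
    have := hδ' s hs
    rwa [e] at this
  have hT0 : (0 : ℕ → ℝ) ∈ {x | cons 0 x ∈ lpBall q r} := by
    have e : cons 0 (0 : ℕ → ℝ) = 0 := by funext j; cases j <;> rfl
    show cons 0 0 ∈ lpBall q r
    rw [e]
    exact zero_mem_lpBall hr
  refine Represents.unique (u := ψ) (hT.inter hS) ⟨hT0, h0⟩ (fun x hx => ?_)
    (fun x hx => ha x hx.2)
  have h1 := hasSum_restrict (z := cons 0 x) rfl (hu.iterate (coordOpen_lpBall r) 0 k _ hx.1)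
  rwa [h _ hx.1 rfl] at h1

/-- The majorants of the derivatives of a series that converges on a ball of `ℓ^q` are uniformly
bounded on a smaller ball. -/
theorem exists_majorant_DL_le {c : (ℕ →₀ ℕ) → ℝ} {r : ℝ} (hr : 0 < r)
    (h : ∀ z ∈ lpBall q r, majorant c z ≠ ⊤) (n : ℕ) :
    ∃ ε > 0, ∃ C : ℝ, 0 ≤ C ∧ ∀ L : List ℕ, L.length ≤ n → ∀ z ∈ lpBall q ε,
      majorant (DL L c) z ≤ ENNReal.ofReal C := by
  obtain ⟨ε, hε, M, hM⟩ := exists_majorant_le hr h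
  obtain ⟨η, hη0, hη1, hηn⟩ := exists_mul_natCast_le (half_pos hε) n
  refine ⟨ε / 2, by positivity, (η ^ n)⁻¹ * M, by positivity, fun L hL z hz => ?_⟩
  obtain ⟨y, hy, rfl⟩ := mem_lpBall.1 hz
  obtain ⟨x, hx, hxn⟩ := exists_lp_add_count y hη0.le L
  have hLn : η * L.length ≤ η * n := by gcongr
  refine (majorant_DL_le_of_length_le c hη0 hη1 hL hx).trans ?_
  rw [ENNReal.ofReal_mul (by positivity), ENNReal.ofReal_inv_of_pos (by positivity),
    ENNReal.ofReal_natCast]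
  gcongr
  exact hM _ (coe_mem_lpBall (by linarith))

/-- A series with bounded majorant is close to its constant term near `0`. -/
theorem abs_sub_const_le {c : (ℕ →₀ ℕ) → ℝ} {ε C l s : ℝ} (hC : 0 ≤ C)
    (h : ∀ z ∈ lpBall q ε, majorant c z ≤ ENNReal.ofReal C) (h0 : 0 < l) (h1 : l ≤ 1)
    {z : ℕ → ℝ} (hz : z ∈ lpBall q (l * ε)) (hs : HasSum (fun α => c α * monomial z α) s) :
    |s - c 0| ≤ l * C := by
  refine abs_le_of_hasSum (c := c - fun α => if α = 0 then c 0 else 0)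
    (hasSum_sub_coeff hs (hasSum_const (c 0) z)) (by positivity) ?_
  have e : z = l • (l⁻¹ • z) := by rw [smul_smul, mul_inv_cancel₀ h0.ne', one_smul]
  rw [e]
  refine (majorant_smul_le (by simp) h0.le h1 _).trans ?_
  rw [ENNReal.ofReal_mul h0.le]
  gcongr
  exact (majorant_sub_const_le _ _).trans (h _ (smul_mem_lpBall h0 hz))

/-- If two series satisfy an equation whose right-hand side is Lipschitz in the jet, and their
difference is of order `l + m` in `t`, then the `m`-th derivative of the difference in `t`, which
is of order `l`, is even of order `l + 1`. -/
theorem VanishesBelow.D_iterate_of_lipschitz (hm : 0 < m) {ε : ℝ} (hε : 0 < ε)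
    {c₁ c₂ : (ℕ →₀ ℕ) → ℝ} {u₁ u₂ : (ℕ → ℝ) → ℝ} (h₁ : Represents (lpBall q ε) c₁ u₁)
    (h₂ : Represents (lpBall q ε) c₂ u₂) {C : ℝ} (hC0 : 0 ≤ C)
    (hC : ∀ L : List ℕ, L.length ≤ m → ∀ z ∈ lpBall q ε,
      majorant (DL L (c₁ - c₂)) z ≤ ENNReal.ofReal C) {K : ℝ}
    (hK : ∀ z ∈ lpBall q ε, ∀ δ : ℝ, 0 ≤ δ → (∀ a, |jet m u₁ z a - jet m u₂ z a| ≤ δ) →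
      |(InfCK.partialDeriv 0)^[m] u₁ z - (InfCK.partialDeriv 0)^[m] u₂ z| ≤ K * δ)
    {l : ℕ} (hv : VanishesBelow (l + m) (c₁ - c₂)) :
    VanishesBelow (l + 1) ((D 0)^[m] (c₁ - c₂)) := by
  have hS := coordOpen_lpBall (q := q) ε
  set b := (D 0)^[m] (c₁ - c₂) with hb
  have hbl : VanishesBelow l b := VanishesBelow.D_zero_iterate m hv
  -- the part of `b` that is homogeneous of degree `l` in `t`
  set b₁ : (ℕ →₀ ℕ) → ℝ := fun α => if α 0 = l then b α else 0 with hb₁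
  have hb₂ : VanishesBelow (l + 1) (b - b₁) := by
    intro α hα
    rcases Nat.lt_succ_iff_lt_or_eq.1 hα with h | h
    · simp [hb₁, h.ne, hbl α h]
    · simp [hb₁, h]
  have hbC : ∀ z ∈ lpBall q ε, majorant b z ≤ ENNReal.ofReal C := by
    intro z hz
    have := hC (List.replicate m 0) (by simp) z hz
    rwa [DL_replicate] at this
  have hb₁C : ∀ z, majorant b₁ z ≤ majorant b z := fun z => ENNReal.tsum_le_tsum fun α => by
    simp only [hb₁]; split_ifs <;> simp
  have hb₂C : ∀ z, majorant (b - b₁) z ≤ majorant b z := fun z => ENNReal.tsum_le_tsum fun α => by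
    simp only [hb₁, Pi.sub_apply]; split_ifs <;> simp
  have hjet : ∀ a : JetIndex m, ∀ z ∈ lpBall q ε, ∀ τ : ℝ, 0 ≤ τ → τ ≤ 1 →
      majorant (jetCoeff c₁ a - jetCoeff c₂ a) (Function.update z 0 (τ * z 0))
        ≤ ENNReal.ofReal (τ ^ (l + 1) * C) := by
    intro a z hz τ h0 h1
    have key : ∀ L : List ℕ, L.length ≤ m → VanishesBelow (l + 1) (DL L (c₁ - c₂)) →
        majorant (DL L c₁ - DL L c₂) (Function.update z 0 (τ * z 0))
          ≤ ENNReal.ofReal (τ ^ (l + 1) * C) := by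
      intro L hL hvL
      rw [← DL_sub, ENNReal.ofReal_mul (by positivity)]
      exact (hvL.majorant_le h0 h1 z).trans (by gcongr; exact hC L hL z hz)
    cases a with
    | time => simp [jetCoeff, majorant]
    | space i => simp [jetCoeff, majorant]
    | value => exact key [] (by simp) (hv.mono (by omega))
    | der i => exact key _ (jetList_length_le i) (hv.DL_jetList i)
  have hzero : Represents (lpBall q ε) b₁ fun _ => 0 := by
    intro z hz
    have hsum : Summable fun α => b₁ α * monomial z α := summable_iff_majorant.2
      (ne_top_of_le_ne_top ENNReal.ofReal_ne_top ((hb₁C z).trans (hbC z hz)))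
    set s := ∑' α, b₁ α * monomial z α with hs
    -- at `(τ t, x)` the terms of `b₁` scale like `τ ^ l`, while the equation bounds the sum of `b` by
    -- a multiple of `τ ^ (l + 1)`
    have hbound : ∀ τ : ℝ, 0 < τ → τ ≤ 1 → |s| ≤ τ * (K * C + C) := by
      intro τ h0 h1
      set z' := Function.update z 0 (τ * z 0) with hz'
      have hz'm : z' ∈ lpBall q ε := lpBall_solid hz fun i => by
        by_cases hi : i = 0
        · subst hi
          rw [hz', Function.update_self, abs_mul, abs_of_pos h0]
          exact mul_le_of_le_one_left (abs_nonneg _) h1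
        · simp [hz', hi]
      have e1 := hK z' hz'm (τ ^ (l + 1) * C) (by positivity) fun a =>
        abs_le_of_hasSum (hasSum_sub_coeff (represents_jet hS h₁ a z' hz'm)
          (represents_jet hS h₂ a z' hz'm)) (by positivity) (hjet a z hz τ h0.le h1)
      have e2 : HasSum (fun α => b α * monomial z' α)
          ((InfCK.partialDeriv 0)^[m] u₁ z' - (InfCK.partialDeriv 0)^[m] u₂ z') := by
        rw [hb, ← DL_replicate, DL_sub, DL_replicate, DL_replicate]
        exact hasSum_sub_coeff (h₁.iterate hS 0 m z' hz'm) (h₂.iterate hS 0 m z' hz'm)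
      have e3 : HasSum (fun α => b₁ α * monomial z' α) (τ ^ l * s) := by
        refine (hsum.hasSum.mul_left (τ ^ l)).congr_fun fun α => ?_
        rw [hz', monomial_update_mul]
        simp only [hb₁]
        split_ifs with h
        · rw [h]; ring
        · simp
      have e4 := abs_le_of_hasSum (hasSum_sub_coeff e2 e3) (C := τ ^ (l + 1) * C) (by positivity) (by
          rw [ENNReal.ofReal_mul (by positivity)]
          refine (hb₂.majorant_le h0.le h1 z).trans ?_
          gcongr
          exact (hb₂C z).trans (hbC z hz))
      have e5 : |τ ^ l * s| ≤ K * (τ ^ (l + 1) * C) + τ ^ (l + 1) * C := by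
        rw [abs_le] at e1 e4 ⊢
        constructor <;> linarith [e1.1, e1.2, e4.1, e4.2]
      rw [abs_mul, abs_of_pos (pow_pos h0 l)] at e5
      refine le_of_mul_le_mul_left (e5.trans_eq ?_) (pow_pos h0 l)
      ring
    have hs0 : s = 0 := by
      by_contra hne
      have hpos := abs_pos.2 hne
      have hB := hbound 1 one_pos le_rfl
      rw [one_mul] at hB
      have hB0 := hpos.trans_le hB
      obtain ⟨B, hBe⟩ : ∃ B, B = K * C + C := ⟨_, rfl⟩
      rw [← hBe] at hB0 hbound
      have h1 := hbound (min 1 (|s| / (2 * B))) (by positivity) (min_le_left _ _)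
      have h2 : min 1 (|s| / (2 * B)) * B ≤ |s| / 2 := by
        calc _ ≤ |s| / (2 * B) * B := by gcongr; exact min_le_right _ _
          _ = |s| / 2 := by field_simp
      linarith
    rw [← hs0]
    exact hsum.hasSum
  have hb₁0 : b₁ = 0 := hzero.unique hS (zero_mem_lpBall hε) fun z _ => by
    simp [hasSum_zero]
  intro α hα
  have := hb₂ α hα
  rwa [hb₁0, sub_zero] at this

/-- Two solutions have the same coefficients, since by induction their difference is of every
order in `t`. -/
theorem eqOn_of_isLocalAnalyticSolution (hm : 0 < m) {p : ℝ} (hp : 1 ≤ p)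
    {A : Set (JetIndex m → ℝ)} {f : (JetIndex m → ℝ) → ℝ} {E : ℕ → Set (ℕ → ℝ)}
    {φ : ℕ → (ℕ → ℝ) → ℝ} (hφ : ∀ k < m, AnalyticNearInfty p (E k) (φ k) 0)
    (hf : AnalyticNearInfty p A f (jetCenter m φ)) {r₁ r₂ : ℝ} {u₁ u₂ : (ℕ → ℝ) → ℝ}
    (h₁ : IsLocalAnalyticSolution m q A f E φ r₁ u₁)
    (h₂ : IsLocalAnalyticSolution m q A f E φ r₂ u₂) :
    Set.EqOn u₁ u₂ (lpBall q r₁ ∩ lpBall q r₂) := by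
  obtain ⟨cf, vf, ⟨hvf0, hvfs, hvf⟩, hvfn⟩ := hf
  choose! cφ vφ hφ using hφ
  obtain ⟨ν, hν, hνv⟩ := hvfn.exists_le (by linarith)
  obtain ⟨c₁, -, hc₁⟩ := h₁.analytic
  obtain ⟨c₂, -, hc₂⟩ := h₂.analytic
  suffices hc : c₁ = c₂ by
    intro z hz
    exact (hc₁ z hz.1).unique (hc ▸ hc₂ z hz.2)
  have hres : ∀ {r u c}, IsLocalAnalyticSolution m q A f E φ r u → Represents (lpBall q r) c u →
      ∀ k < m, restrict ((D 0)^[k] c) = cφ k := fun h hc k hk =>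
    restrict_D_iterate_eq h.pos hc (coordOpen_box (vφ k)) (fun i => by simpa using (hφ k hk).1.1 i)
      (hφ k hk).1.represents fun z hz hz0 => (h.initial k hk z hz hz0).2
  have hcenter : ∀ {c}, (∀ k < m, restrict ((D 0)^[k] c) = cφ k) →
      ∀ a, jetCenter m φ a = jetCoeff c a 0 := fun hc a =>
    jetCenter_eq hm (fun k _ => coordOpen_box (vφ k))
      (fun k hk i => by simpa using (hφ k hk).1.1 i) (fun k hk => (hφ k hk).1.represents) hc a
  obtain ⟨ε₁, hε₁, C₁, hC₁0, hC₁⟩ := exists_majorant_DL_le h₁.pos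
    (fun z hz => Represents.majorant_ne_top hc₁ hz) m
  obtain ⟨ε₂, hε₂, C₂, hC₂0, hC₂⟩ := exists_majorant_DL_le h₂.pos
    (fun z hz => Represents.majorant_ne_top hc₂ hz) m
  set ε := min (min ε₁ r₁) (min ε₂ r₂) with hε
  have hε0 : 0 < ε := lt_min (lt_min hε₁ h₁.pos) (lt_min hε₂ h₂.pos)
  set C := C₁ + C₂ with hC
  set l := min 1 (ν / (2 * (C + ε + 1))) with hl
  have hC0 : 0 ≤ C := by positivity
  have hl0 : 0 < l := by positivity
  have hl1 : l ≤ 1 := min_le_left _ _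
  have hlC : l * (C + ε + 1) ≤ ν / 2 := by
    have h1 : l ≤ ν / (2 * (C + ε + 1)) := min_le_right _ _
    rw [le_div_iff₀ (by positivity)] at h1
    linarith
  have hlε : l * ε ≤ ε := mul_le_of_le_one_left hε0.le hl1
  have hlC' : 0 ≤ l * C := by positivity
  have hlε' : 0 < l * ε := by positivity
  have hle₁ : ε ≤ ε₁ := (min_le_left _ _).trans (min_le_left _ _)
  have hle₁' : ε ≤ r₁ := (min_le_left _ _).trans (min_le_right _ _)
  have hle₂ : ε ≤ ε₂ := (min_le_right _ _).trans (min_le_left _ _)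
  have hle₂' : ε ≤ r₂ := (min_le_right _ _).trans (min_le_right _ _)
  -- on the ball of radius `l * ε` the jets stay where `f` is known to be Lipschitz
  have hnear : ∀ {c u}, Represents (lpBall q ε) c u →
      (∀ L : List ℕ, L.length ≤ m → ∀ z ∈ lpBall q ε, majorant (DL L c) z ≤ ENNReal.ofReal C) →
      (∀ k < m, restrict ((D 0)^[k] c) = cφ k) → ∀ z ∈ lpBall q (l * ε), ∀ a : JetIndex m,
        |jet m u z a - jetCenter m φ a| ≤ |vf a| / 2 := by
    intro c u hu hb hr z hz a
    suffices h : |jet m u z a - jetCenter m φ a| ≤ ν / 2 by linarith [hνv a]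
    have hz' := represents_jet (coordOpen_lpBall ε) hu a z (lpBall_mono hlε hz)
    cases a with
    | time =>
      have := abs_lt_of_mem_lpBall hz 0
      show |z 0 - 0| ≤ _
      rw [sub_zero]
      nlinarith
    | space i =>
      have := abs_lt_of_mem_lpBall hz (i + 1)
      show |z (i + 1) - 0| ≤ _
      rw [sub_zero]
      nlinarith
    | value =>
      rw [hcenter hr]
      have := abs_sub_const_le hC0 (hb [] (by simp)) hl0 hl1 hz hz'
      refine this.trans ?_
      nlinarith
    | der b =>
      rw [hcenter hr]
      have := abs_sub_const_le hC0 (hb _ (jetList_length_le b)) hl0 hl1 hz hz'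
      refine this.trans ?_
      nlinarith
  have hr₁ := hres h₁ hc₁
  have hr₂ := hres h₂ hc₂
  have hn₁ := hnear (Represents.mono hc₁ (lpBall_mono hle₁')) (fun L hL z hz =>
    (hC₁ L hL z (lpBall_mono hle₁ hz)).trans (ENNReal.ofReal_le_ofReal (by linarith))) hr₁
  have hn₂ := hnear (Represents.mono hc₂ (lpBall_mono hle₂')) (fun L hL z hz =>
    (hC₂ L hL z (lpBall_mono hle₂ hz)).trans (ENNReal.ofReal_le_ofReal (by linarith))) hr₂
  have hvfs' : Summable fun α => |cf α * monomial (fun a => |vf a|) α| := by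
    refine hvfs.congr fun α => ?_
    rw [abs_mul, abs_mul, abs_monomial, abs_monomial]
    simp
  set M := ∑' α, |cf α * monomial (fun a => |vf a|) α| with hM
  have hfsum : ∀ {r u}, IsLocalAnalyticSolution m q A f E φ r u → ∀ z ∈ lpBall q r,
      (∀ a, |jet m u z a - jetCenter m φ a| ≤ |vf a| / 2) →
      (InfCK.partialDeriv 0)^[m] u z
        = ∑' α, cf α * monomial (jet m u z - jetCenter m φ) α := by
    intro r u h z hz hjet
    have h1 := (hvf (jet m u z - jetCenter m φ) fun a =>
      (hjet a).trans (half_le_self (abs_nonneg _))).2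
    rw [add_sub_cancel] at h1
    rw [(h.equation z hz).2, h1.tsum_eq]
  have hlip : ∀ z ∈ lpBall q (l * ε), ∀ δ : ℝ, 0 ≤ δ →
      (∀ a, |jet m u₁ z a - jet m u₂ z a| ≤ δ) →
      |(InfCK.partialDeriv 0)^[m] u₁ z - (InfCK.partialDeriv 0)^[m] u₂ z| ≤ M / ν * δ := by
    intro z hz δ hδ hjet
    rw [hfsum h₁ z (lpBall_mono (hlε.trans hle₁') hz) (hn₁ z hz),
      hfsum h₂ z (lpBall_mono (hlε.trans hle₂') hz) (hn₂ z hz)]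
    have h3 := norm_tsum_sub_le (L := δ / ν) (by positivity) hvfs' (hn₁ z hz) (hn₂ z hz) fun a => by
      rw [Real.norm_eq_abs, sub_sub_sub_cancel_right, div_mul_eq_mul_div]
      refine (hjet a).trans ?_
      rw [le_div_iff₀ hν]
      exact mul_le_mul_of_nonneg_left (hνv a) hδ
    refine h3.trans_eq ?_
    rw [← hM]
    ring
  have hd : ∀ k < m, restrict ((D 0)^[k] (c₁ - c₂)) = 0 := by
    intro k hk
    have e : (D 0)^[k] (c₁ - c₂) = (D 0)^[k] c₁ - (D 0)^[k] c₂ := by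
      rw [← DL_replicate, ← DL_replicate, ← DL_replicate, DL_sub]
    have e' := sub_eq_zero.2 ((hr₁ k hk).trans (hr₂ k hk).symm)
    rw [e]
    exact e'
  have hv : ∀ k, VanishesBelow k ((D 0)^[m] (c₁ - c₂)) := by
    intro k
    induction k with
    | zero => exact fun α hα => absurd hα (Nat.not_lt_zero _)
    | succ k ih =>
      refine VanishesBelow.D_iterate_of_lipschitz hm hlε'
        (Represents.mono hc₁ (lpBall_mono (hlε.trans hle₁')))
        (Represents.mono hc₂ (lpBall_mono (hlε.trans hle₂'))) hC0 (fun L hL z hz => ?_) hlip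
        (vanishesBelow_add hd ih)
      rw [DL_sub, hC, ENNReal.ofReal_add hC₁0 hC₂0]
      exact (majorant_sub_le _ _ _).trans
        (add_le_add (hC₁ L hL z (lpBall_mono (hlε.trans hle₁) hz))
          (hC₂ L hL z (lpBall_mono (hlε.trans hle₂) hz)))
  refine sub_eq_zero.1 (funext fun α => ?_)
  exact vanishesBelow_add hd (hv (α 0 + 1)) α (by omega)

end Uniqueness

end InfCK

end

theorem mainTheorem7 (m : ℕ) (hm : 0 < m) (p : ℝ) (hp : 1 ≤ p)
    (q : ℝ≥0∞) [Fact (1 ≤ q)] (hpq : (ENNReal.ofReal p).HolderConjugate q)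
    (D : Set (InfCK.JetIndex m → ℝ)) (f : (InfCK.JetIndex m → ℝ) → ℝ)
    (E : ℕ → Set (ℕ → ℝ)) (φ : ℕ → (ℕ → ℝ) → ℝ)
    (hφ : ∀ k < m, InfCK.AnalyticNearInfty p (E k) (φ k) 0)
    (hf : InfCK.AnalyticNearInfty p D f (InfCK.jetCenter m φ)) :
    (∃ (r : ℝ) (u : (ℕ → ℝ) → ℝ), InfCK.IsLocalAnalyticSolution m q D f E φ r u) ∧
    (∀ (r₁ r₂ : ℝ) (u₁ u₂ : (ℕ → ℝ) → ℝ),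
      InfCK.IsLocalAnalyticSolution m q D f E φ r₁ u₁ →
      InfCK.IsLocalAnalyticSolution m q D f E φ r₂ u₂ →
      Set.EqOn u₁ u₂ (InfCK.lpBall q r₁ ∩ InfCK.lpBall q r₂)) ∧
    (∀ (r : ℝ) (u : (ℕ → ℝ) → ℝ),
      InfCK.IsLocalAnalyticSolution m q D f E φ r u →
      ∃ s : ℝ, 0 < s ∧ s ≤ r ∧
        (∀ y ∈ Metric.ball (0 : lp (fun _ : ℕ => ℝ) q) s,
          DifferentiableAt ℝ (fun y : lp (fun _ : ℕ => ℝ) q => u (y : ℕ → ℝ)) y) ∧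
        ContinuousOn (fderiv ℝ (fun y : lp (fun _ : ℕ => ℝ) q => u (y : ℕ → ℝ)))
          (Metric.ball 0 s)) := by
  refine ⟨InfCK.exists_isLocalAnalyticSolution hm hp hpq hφ hf, fun _ _ _ _ h₁ h₂ =>
    InfCK.eqOn_of_isLocalAnalyticSolution hm hp hφ hf h₁ h₂, fun r u hu => ?_⟩
  obtain ⟨c, -, hc⟩ := hu.analytic
  exact InfCK.exists_continuousOn_fderiv hu.pos hc
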